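/- Let $n\ge 1$ and $s\ge 2$ be integers, let $M$ be a smooth manifold of dimension $2n+s$ with a Riemannian metric $g$ and Levi-Civita connection $\nabla$, and let $\mathfrak X_M$ be the set of smooth vector fields on $M$. Let $f,Q$ be smooth $(1,1)$-tensors, $\xi_1,\dots,\xi_s$ smooth vector fields and $\eta^1,\dots,\eta^s$ smooth 1-forms on $M$ such that $f$ has rank $2n$, $Q$ is nonsingular, the distribution $\bigcap_i\ker\eta^i$ is $f$-invariant, and for all $X,Y\in\mathfrak X_M$ $$f^3+fQ=0,\quad f^2=-Q+\sum_i\eta^i\otimes\xi_i,\quad \eta^i(\xi_j)=\delta^i_j,\quad Q\xi_i=\xi_i,\quad g(fX,fY)=g(X,QY)-\sum_i\eta^i(X)\,\eta^i(Y)$$ (a weak metric $f$-structure). Put $\bar\xi=\sum_i\xi_i$ and $\bar\eta=\sum_i\eta^i$, and let $\beta\ne0$ be a constant. Assume that $M$ is a weak $\beta$-Kenmotsu $f$-manifold, i.e. that for all $X,Y\in\mathfrak X_M$ $$[f,f](X,Y)+2\sum_i d\eta^i(X,Y)\,\xi_i=0,\qquad (\nabla_Xf)Y=\beta\{g(fX,Y)\,\bar\xi-\bar\eta(Y)\,fX\},$$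 where $[f,f](X,Y)=f^2[X,Y]+[fX,fY]-f[fX,Y]-f[X,fY]$ and $d\omega(X,Y)=\frac12\{X(\omega(Y))-Y(\omega(X))-\omega([X,Y])\}$. Let $R_{X,Y}=[\nabla_X,\nabla_Y]-\nabla_{[X,Y]}$, $\mathrm{Ric}(X,Y)=\mathrm{trace}(Z\mapsto R_{Z,X}Y)$, $g(\mathrm{Ric}^\sharp X,Y)=\mathrm{Ric}(X,Y)$ and $r=\mathrm{trace}_g\mathrm{Ric}$. Then $\mathrm{Ric}^\sharp X$ (for every $X\in\mathfrak X_M$) and $r$ are differentiable, and for every $1\le i\le s$ and all $X,Y\in\mathfrak X_M$ $$R_{X,Y}\,\xi_i=\beta^2\Big\{\bar\eta(X)Y-\bar\eta(Y)X+\sum_p\big(\bar\eta(Y)\eta^p(X)-\bar\eta(X)\eta^p(Y)\big)\xi_p\Big\},$$ $$\mathrm{Ric}^\sharp\xi_i=-2n\beta^2\,\bar\xi,$$ $$(\nabla_{\xi_i}\mathrm{Ric}^\sharp)X=-2\beta\,\mathrm{Ric}^\sharp X-4n\beta^3\Big\{s\Big(X-\sum_j\eta^j(X)\,\xi_j\Big)+\bar\eta(X)\,\bar\xi\Big\},$$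 $$\xi_i(r)=-2\beta\big(r+2sn(2n+1)\beta^2\big).$$ -/

import Mathlib

open Bundle VectorField Module
open scoped Manifold ContDiff

namespace WeakKenmotsu

set_option linter.unusedSectionVars false

variable {E : Type*} [NormedAddCommGroup E] [NormedSpace ℝ E] [FiniteDimensional ℝ E]
  {H : Type*} [TopologicalSpace H] {I : ModelWithCorners ℝ E H}
  {M : Type*} [TopologicalSpace M] [ChartedSpace H M] [IsManifold I ∞ M]
  [RiemannianBundle (fun x : M ↦ TangentSpace I x)]

instance (x : M) : FiniteDimensional ℝ (TangentSpace I x) :=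
  inferInstanceAs (FiniteDimensional ℝ E)

/-- An orthonormal basis of the tangent space `T_x M` with respect to the metric `g_x`. -/
noncomputable def frame (x : M) :
    OrthonormalBasis (Fin (finrank ℝ (TangentSpace I x))) ℝ (TangentSpace I x) :=
  stdOrthonormalBasis ℝ (TangentSpace I x)

/-- The Koszul expression: half of
`X g(Y,Z) + Y g(Z,X) - Z g(X,Y) + g([X,Y],Z) - g([Y,Z],X) + g([Z,X],Y)`, at the point `x`. -/
noncomputable def koszul (X Y Z : Π x : M, TangentSpace I x) (x : M) : ℝ :=
  (1 / 2) * (d% (fun y ↦ inner ℝ (Y y) (Z y)) x (X x) + d% (fun y ↦ inner ℝ (Z y) (X y)) x (Y x)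
    - d% (fun y ↦ inner ℝ (X y) (Y y)) x (Z x)
    + inner ℝ (mlieBracket I X Y x) (Z x) - inner ℝ (mlieBracket I Y Z x) (X x)
    + inner ℝ (mlieBracket I Z X x) (Y x))

variable [IsContMDiffRiemannianBundle I ∞ E (fun x : M ↦ TangentSpace I x)]

theorem mdifferentiableAt_inner {X Y : Π x : M, TangentSpace I x} {x : M}
    (hX : MDiffAt (T% X) x) (hY : MDiffAt (T% Y) x) :
    MDiffAt (fun y ↦ (inner ℝ (X y) (Y y) : ℝ)) x :=
  MDifferentiableAt.inner_bundle (F := E) (E := fun x : M ↦ TangentSpace I x) hX hY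

theorem koszul_tensorial₁ {Y Z : Π x : M, TangentSpace I x} {x : M}
    (hY : MDiffAt (T% Y) x) (hZ : MDiffAt (T% Z) x) :
    TensorialAt I E (fun X ↦ koszul X Y Z x) x where
  smul {f X} hf hX := by
    have h1 : d% (fun y ↦ inner ℝ (Z y) ((f • X) y)) x
        = f x • d% (fun y ↦ inner ℝ (Z y) (X y)) x + inner ℝ (Z x) (X x) • d% f x := by
      have := mvfderiv_mul hf (mdifferentiableAt_inner hZ hX)
      rw [← this]
      congr 1
      ext y; simp [inner_smul_right]
    have h2 : d% (fun y ↦ inner ℝ ((f • X) y) (Y y)) x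
        = f x • d% (fun y ↦ inner ℝ (X y) (Y y)) x + inner ℝ (X x) (Y x) • d% f x := by
      have := mvfderiv_mul hf (mdifferentiableAt_inner hX hY)
      rw [← this]
      congr 1
      ext y; simp [inner_smul_left]
    simp only [koszul, h1, h2, mlieBracket_smul_left hf hX, mlieBracket_smul_right hf hX]
    simp [inner_add_left, inner_smul_left, inner_smul_right, real_inner_comm]
    ring
  add {X X'} hX hX' := by
    have h1 : d% (fun y ↦ inner ℝ (Z y) ((X + X') y)) x
        = d% (fun y ↦ inner ℝ (Z y) (X y)) x + d% (fun y ↦ inner ℝ (Z y) (X' y)) x := by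
      rw [← mvfderiv_add (mdifferentiableAt_inner hZ hX) (mdifferentiableAt_inner hZ hX')]
      congr 1
      ext y; simp [inner_add_right]
    have h2 : d% (fun y ↦ inner ℝ ((X + X') y) (Y y)) x
        = d% (fun y ↦ inner ℝ (X y) (Y y)) x + d% (fun y ↦ inner ℝ (X' y) (Y y)) x := by
      rw [← mvfderiv_add (mdifferentiableAt_inner hX hY) (mdifferentiableAt_inner hX' hY)]
      congr 1
      ext y; simp [inner_add_left]
    simp only [koszul, h1, h2, mlieBracket_add_left hX hX', mlieBracket_add_right hX hX']
    simp [inner_add_left, inner_add_right]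
    ring

theorem koszul_tensorial₃ {X Y : Π x : M, TangentSpace I x} {x : M}
    (hX : MDiffAt (T% X) x) (hY : MDiffAt (T% Y) x) :
    TensorialAt I E (fun Z ↦ koszul X Y Z x) x where
  smul {f Z} hf hZ := by
    have h1 : d% (fun y ↦ inner ℝ (Y y) ((f • Z) y)) x
        = f x • d% (fun y ↦ inner ℝ (Y y) (Z y)) x + inner ℝ (Y x) (Z x) • d% f x := by
      rw [← mvfderiv_mul hf (mdifferentiableAt_inner hY hZ)]
      congr 1
      ext y; simp [inner_smul_right]
    have h2 : d% (fun y ↦ inner ℝ ((f • Z) y) (X y)) x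
        = f x • d% (fun y ↦ inner ℝ (Z y) (X y)) x + inner ℝ (Z x) (X x) • d% f x := by
      rw [← mvfderiv_mul hf (mdifferentiableAt_inner hZ hX)]
      congr 1
      ext y; simp [inner_smul_left]
    simp only [koszul, h1, h2, mlieBracket_smul_left hf hZ, mlieBracket_smul_right hf hZ]
    simp [inner_add_left, inner_smul_left, inner_smul_right, real_inner_comm]
    ring
  add {Z Z'} hZ hZ' := by
    have h1 : d% (fun y ↦ inner ℝ (Y y) ((Z + Z') y)) x
        = d% (fun y ↦ inner ℝ (Y y) (Z y)) x + d% (fun y ↦ inner ℝ (Y y) (Z' y)) x := by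
      rw [← mvfderiv_add (mdifferentiableAt_inner hY hZ) (mdifferentiableAt_inner hY hZ')]
      congr 1
      ext y; simp [inner_add_right]
    have h2 : d% (fun y ↦ inner ℝ ((Z + Z') y) (X y)) x
        = d% (fun y ↦ inner ℝ (Z y) (X y)) x + d% (fun y ↦ inner ℝ (Z' y) (X y)) x := by
      rw [← mvfderiv_add (mdifferentiableAt_inner hZ hX) (mdifferentiableAt_inner hZ' hX)]
      congr 1
      ext y; simp [inner_add_left]
    simp only [koszul, h1, h2, mlieBracket_add_left hZ hZ', mlieBracket_add_right hZ hZ']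
    simp [inner_add_left, inner_add_right]
    ring

open scoped Classical in
/-- For a field `Y` differentiable at `x`, the bilinear form on `T_x M` that sends `(X x, Z x)` to
the Koszul expression of `(X, Y, Z)` at `x` (zero if `Y` is not differentiable at `x`). -/
noncomputable def koszulForm (Y : Π x : M, TangentSpace I x) (x : M) :
    TangentSpace I x →L[ℝ] TangentSpace I x →L[ℝ] ℝ :=
  if hY : MDiffAt (T% Y) x then
    TensorialAt.mkHom₂ (fun X Z ↦ koszul X Y Z x) x
      (fun _ hZ ↦ koszul_tensorial₁ hY hZ) (fun _ hX ↦ koszul_tensorial₃ hX hY)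
  else 0

theorem koszulForm_apply {X Y Z : Π x : M, TangentSpace I x} {x : M}
    (hX : MDiffAt (T% X) x) (hY : MDiffAt (T% Y) x) (hZ : MDiffAt (T% Z) x) :
    koszulForm Y x (X x) (Z x) = koszul X Y Z x := by
  rw [koszulForm, dif_pos hY]
  exact TensorialAt.mkHom₂_apply (Φ := fun X Z ↦ koszul X Y Z x)
    (fun _ hZ ↦ koszul_tensorial₁ hY hZ) (fun _ hX ↦ koszul_tensorial₃ hX hY) hX hZ

/-- The linear map `u ↦ (∇_u Y)(x)`: the Koszul form with its last argument turned into a vector by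
the metric. -/
noncomputable def nabla (Y : Π x : M, TangentSpace I x) (x : M) :
    TangentSpace I x →L[ℝ] TangentSpace I x :=
  ∑ a, ((koszulForm Y x).flip (frame x a)).smulRight (frame x a)

theorem inner_nabla (Y : Π x : M, TangentSpace I x) (x : M) (u w : TangentSpace I x) :
    inner ℝ (nabla Y x u) w = koszulForm Y x u w := by
  conv_rhs => rw [← (frame x).sum_repr' w]
  simp [nabla, sum_inner, inner_smul_left, mul_comm]

theorem inner_nabla_eq_koszul {X Y Z : Π x : M, TangentSpace I x} {x : M}
    (hX : MDiffAt (T% X) x) (hY : MDiffAt (T% Y) x) (hZ : MDiffAt (T% Z) x) :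
    inner ℝ (nabla Y x (X x)) (Z x) = koszul X Y Z x := by
  rw [inner_nabla, koszulForm_apply hX hY hZ]

theorem ext_inner_extend {x : M} {A B : TangentSpace I x →L[ℝ] TangentSpace I x}
    (h : ∀ X Z : Π x : M, TangentSpace I x, MDiffAt (T% X) x → MDiffAt (T% Z) x →
      (inner ℝ (A (X x)) (Z x) : ℝ) = inner ℝ (B (X x)) (Z x)) : A = B := by
  ext u
  refine ext_inner_right ℝ fun w ↦ ?_
  have := h (FiberBundle.extend E u) (FiberBundle.extend E w)
    (FiberBundle.mdifferentiableAt_extend ..) (FiberBundle.mdifferentiableAt_extend ..)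
  simpa using this

/-- The Levi-Civita connection of the Riemannian metric. The argument order is that of Mathlib:
`leviCivita Y x (X x)` is `(∇_X Y)(x)`. -/
noncomputable def leviCivita : CovariantDerivative I E (fun x : M ↦ TangentSpace I x) where
  toFun := nabla
  isCovariantDerivativeOnUniv :=
    { add := by
        intro Y Y' x hY hY' _
        refine ext_inner_extend fun X Z hX hZ ↦ ?_
        have hYY : MDiffAt (T% (Y + Y')) x := mdifferentiableAt_add_section hY hY'
        rw [inner_nabla_eq_koszul hX hYY hZ, add_apply, inner_add_left,
          inner_nabla_eq_koszul hX hY hZ, inner_nabla_eq_koszul hX hY' hZ]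
        have h1 : d% (fun y ↦ inner ℝ ((Y + Y') y) (Z y)) x
            = d% (fun y ↦ inner ℝ (Y y) (Z y)) x + d% (fun y ↦ inner ℝ (Y' y) (Z y)) x := by
          rw [← mvfderiv_add (mdifferentiableAt_inner hY hZ) (mdifferentiableAt_inner hY' hZ)]
          congr 1
          ext y; simp [inner_add_left]
        have h2 : d% (fun y ↦ inner ℝ (X y) ((Y + Y') y)) x
            = d% (fun y ↦ inner ℝ (X y) (Y y)) x + d% (fun y ↦ inner ℝ (X y) (Y' y)) x := by
          rw [← mvfderiv_add (mdifferentiableAt_inner hX hY) (mdifferentiableAt_inner hX hY')]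
          congr 1
          ext y; simp [inner_add_right]
        simp only [koszul, h1, h2, mlieBracket_add_left hY hY', mlieBracket_add_right hY hY']
        simp [inner_add_left, inner_add_right]
        ring
      leibniz := by
        intro Y f x hY hf _
        refine ext_inner_extend fun X Z hX hZ ↦ ?_
        have hfY : MDiffAt (T% (f • Y)) x := hf.smul_section hY
        rw [inner_nabla_eq_koszul hX hfY hZ]
        simp only [add_apply, inner_add_left, smul_apply,
          ContinuousLinearMap.smulRight_apply, inner_smul_left]
        rw [inner_nabla_eq_koszul hX hY hZ]
        have h1 : d% (fun y ↦ inner ℝ ((f • Y) y) (Z y)) x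
            = f x • d% (fun y ↦ inner ℝ (Y y) (Z y)) x + inner ℝ (Y x) (Z x) • d% f x := by
          rw [← mvfderiv_mul hf (mdifferentiableAt_inner hY hZ)]
          congr 1
          ext y; simp [inner_smul_left]
        have h2 : d% (fun y ↦ inner ℝ (X y) ((f • Y) y)) x
            = f x • d% (fun y ↦ inner ℝ (X y) (Y y)) x + inner ℝ (X x) (Y x) • d% f x := by
          rw [← mvfderiv_mul hf (mdifferentiableAt_inner hX hY)]
          congr 1
          ext y; simp [inner_smul_right]
        simp only [koszul, h1, h2, mlieBracket_smul_left hf hY, mlieBracket_smul_right hf hY]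
        simp [inner_add_left, inner_smul_left, inner_smul_right, real_inner_comm]
        ring }

/-- The Levi-Civita connection is torsion free. -/
theorem leviCivita_torsion {X Y : Π x : M, TangentSpace I x} {x : M}
    (hX : MDiffAt (T% X) x) (hY : MDiffAt (T% Y) x) :
    leviCivita Y x (X x) - leviCivita X x (Y x) = mlieBracket I X Y x := by
  refine ext_inner_right ℝ fun w ↦ ?_
  have hZ := FiberBundle.mdifferentiableAt_extend I E w
  have hw : w = FiberBundle.extend E w x := by simp
  rw [hw, inner_sub_left]
  change inner ℝ (nabla Y x (X x)) _ - inner ℝ (nabla X x (Y x)) _ = _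
  rw [inner_nabla_eq_koszul hX hY hZ, inner_nabla_eq_koszul hY hX hZ]
  simp only [koszul]
  rw [mlieBracket_swap_apply (V := Y) (W := X),
    mlieBracket_swap_apply (V := FiberBundle.extend E w) (W := X),
    mlieBracket_swap_apply (V := FiberBundle.extend E w) (W := Y)]
  simp only [real_inner_comm, inner_neg_left]
  ring

/-- The Levi-Civita connection is compatible with the metric. -/
theorem leviCivita_metric {X Y Z : Π x : M, TangentSpace I x} {x : M}
    (hX : MDiffAt (T% X) x) (hY : MDiffAt (T% Y) x) (hZ : MDiffAt (T% Z) x) :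
    d% (fun y ↦ (inner ℝ (Y y) (Z y) : ℝ)) x (X x)
      = inner ℝ (leviCivita Y x (X x)) (Z x) + inner ℝ (Y x) (leviCivita Z x (X x)) := by
  rw [real_inner_comm (leviCivita Z x (X x))]
  change _ = inner ℝ (nabla Y x (X x)) _ + inner ℝ (nabla Z x (X x)) _
  rw [inner_nabla_eq_koszul hX hY hZ, inner_nabla_eq_koszul hX hZ hY]
  simp only [koszul]
  rw [mlieBracket_swap_apply (V := Z) (W := Y), mlieBracket_swap_apply (V := Y) (W := X),
    mlieBracket_swap_apply (V := Z) (W := X)]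
  simp only [real_inner_comm, inner_neg_left]
  ring

/-! ### Curvature -/

/-- The curvature operator `R_{X,Y} Z = ∇_X ∇_Y Z - ∇_Y ∇_X Z - ∇_{[X,Y]} Z` on vector fields. -/
noncomputable def curvature (X Y Z : Π x : M, TangentSpace I x) (x : M) : TangentSpace I x :=
  leviCivita (fun y ↦ leviCivita Z y (Y y)) x (X x)
    - leviCivita (fun y ↦ leviCivita Z y (X y)) x (Y x)
    - leviCivita Z x (mlieBracket I X Y x)

/-- The curvature tensor at `x`, evaluated on tangent vectors: the curvature operator applied to
extensions of the vectors to vector fields that are smooth near `x`. -/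
noncomputable def curvatureAt (x : M) (u v w : TangentSpace I x) : TangentSpace I x :=
  curvature (FiberBundle.extend E u) (FiberBundle.extend E v) (FiberBundle.extend E w) x

/-- The Ricci tensor `Ric(u, v) = trace (z ↦ R_{z,u} v)`, the trace being computed in an orthonormal
basis. -/
noncomputable def ricci (x : M) (u v : TangentSpace I x) : ℝ :=
  ∑ a, inner ℝ (curvatureAt x (frame x a) u v) (frame x a)

/-- The Ricci operator `Ric♯`, that is, the vector `Ric♯ u` with `g(Ric♯ u, v) = Ric(u, v)`, given
by its components `Ric(u, e_a)` in an orthonormal basis. -/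
noncomputable def ricciOp (x : M) (u : TangentSpace I x) : TangentSpace I x :=
  ∑ a, ricci x u (frame x a) • frame x a

variable (I) in
/-- The scalar curvature `r = trace_g Ric`. -/
noncomputable def scalarCurvature (x : M) : ℝ :=
  ∑ a, ricci (I := I) x (frame x a) (frame x a)

/-- The covariant derivative of a field of endomorphisms `T` of the tangent spaces:
`(∇_Z T) X = ∇_Z (T X) - T (∇_Z X)`. -/
noncomputable def nablaEndo (T : Π x : M, TangentSpace I x → TangentSpace I x)
    (Z X : Π x : M, TangentSpace I x) (x : M) : TangentSpace I x :=
  leviCivita (fun y ↦ T y (X y)) x (Z x) - T x (leviCivita X x (Z x))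

/-! ### Weak metric `f`-structures -/

/-- The Nijenhuis torsion
`[S,S](X,Y) = S² [X,Y] + [S X, S Y] - S [S X, Y] - S [X, S Y]`. -/
noncomputable def nijenhuis (S : Π x : M, TangentSpace I x →L[ℝ] TangentSpace I x)
    (X Y : Π x : M, TangentSpace I x) (x : M) : TangentSpace I x :=
  S x (S x (mlieBracket I X Y x))
    + mlieBracket I (fun y ↦ S y (X y)) (fun y ↦ S y (Y y)) x
    - S x (mlieBracket I (fun y ↦ S y (X y)) Y x)
    - S x (mlieBracket I X (fun y ↦ S y (Y y)) x)

/-- The exterior derivative of a 1-form,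
`dθ(X,Y) = (1/2) (X(θ(Y)) - Y(θ(X)) - θ([X,Y]))`. -/
noncomputable def extDeriv (θ : Π x : M, TangentSpace I x →L[ℝ] ℝ)
    (X Y : Π x : M, TangentSpace I x) (x : M) : ℝ :=
  (1 / 2) * (d% (fun y ↦ θ y (Y y)) x (X x) - d% (fun y ↦ θ y (X y)) x (Y x)
    - θ x (mlieBracket I X Y x))

/-- A field of endomorphisms of the tangent spaces is a smooth (1,1)-tensor. -/
def IsSmoothEndo (S : Π x : M, TangentSpace I x →L[ℝ] TangentSpace I x) : Prop :=
  ContMDiff I (I.prod 𝓘(ℝ, E →L[ℝ] E)) ∞ (fun x ↦ TotalSpace.mk' (E →L[ℝ] E) x (S x))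

/-- A field of covectors is a smooth 1-form. -/
def IsSmoothForm (θ : Π x : M, TangentSpace I x →L[ℝ] ℝ) : Prop :=
  ContMDiff I (I.prod 𝓘(ℝ, E →L[ℝ] ℝ)) ∞ (fun x ↦ TotalSpace.mk' (E →L[ℝ] ℝ) x (θ x))

/-- The vector field `ξ̄ = ∑ i, ξ_i`. -/
noncomputable def xiBar {s : ℕ} (ξ : Fin s → Π x : M, TangentSpace I x) (x : M) :
    TangentSpace I x :=
  ∑ i, ξ i x

/-- The 1-form `η̄ = ∑ i, η^i`. -/
noncomputable def etaBar {s : ℕ} (η : Fin s → Π x : M, TangentSpace I x →L[ℝ] ℝ) (x : M) :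
    TangentSpace I x →L[ℝ] ℝ :=
  ∑ i, η i x

/-- A weak `f`-structure on a smooth manifold of dimension `2n + s`. -/
structure IsWeakF (n s : ℕ) (f Q : Π x : M, TangentSpace I x →L[ℝ] TangentSpace I x) :
    Prop where
  n_pos : 0 < n
  one_lt_s : 1 < s
  dim : finrank ℝ E = 2 * n + s
  smooth_f : IsSmoothEndo f
  smooth_Q : IsSmoothEndo Q
  rank_f : ∀ x, finrank ℝ (f x).range = 2 * n
  nonsingular_Q : ∀ x, Function.Bijective (Q x)
  cube : ∀ x u, f x (f x (f x u)) + f x (Q x u) = 0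

/-- A framed weak `f`-structure, with `f`-invariant contact distribution `⋂ i, ker η^i`. -/
structure IsFramedWeakF (n s : ℕ) (f Q : Π x : M, TangentSpace I x →L[ℝ] TangentSpace I x)
    (ξ : Fin s → Π x : M, TangentSpace I x)
    (η : Fin s → Π x : M, TangentSpace I x →L[ℝ] ℝ) : Prop extends IsWeakF n s f Q where
  smooth_ξ : ∀ i, CMDiff ∞ (T% (ξ i))
  smooth_η : ∀ i, IsSmoothForm (η i)
  sq : ∀ x u, f x (f x u) = -Q x u + ∑ i, η i x u • ξ i x
  η_ξ : ∀ x i j, η i x (ξ j x) = if i = j then 1 else 0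
  Q_ξ : ∀ x i, Q x (ξ i x) = ξ i x
  invariant : ∀ x u, (∀ i, η i x u = 0) → ∀ i, η i x (f x u) = 0

/-- A weak metric `f`-structure: a framed weak `f`-structure for which the Riemannian metric is
compatible. -/
structure IsWeakMetricF (n s : ℕ) (f Q : Π x : M, TangentSpace I x →L[ℝ] TangentSpace I x)
    (ξ : Fin s → Π x : M, TangentSpace I x)
    (η : Fin s → Π x : M, TangentSpace I x →L[ℝ] ℝ) : Prop
    extends IsFramedWeakF n s f Q ξ η where
  compatible : ∀ (x : M) (u v : TangentSpace I x),
    (inner ℝ (f x u) (f x v) : ℝ) = inner ℝ u (Q x v) - ∑ i, η i x u * η i x v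

/-- A weak `β`-Kenmotsu `f`-manifold: a weak metric `f`-manifold that is normal, with
`(∇_X f) Y = β (g(f X, Y) ξ̄ - η̄(Y) f X)` for a smooth function `β` without zeros. -/
structure IsWeakKenmotsuF (n s : ℕ) (f Q : Π x : M, TangentSpace I x →L[ℝ] TangentSpace I x)
    (ξ : Fin s → Π x : M, TangentSpace I x)
    (η : Fin s → Π x : M, TangentSpace I x →L[ℝ] ℝ) (β : M → ℝ) : Prop
    extends IsWeakMetricF n s f Q ξ η where
  normal : ∀ X Y : Π x : M, TangentSpace I x, CMDiff ∞ (T% X) → CMDiff ∞ (T% Y) → ∀ x,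
    nijenhuis f X Y x + ∑ i, (2 * extDeriv (η i) X Y x) • ξ i x = 0
  smooth_β : CMDiff ∞ β
  β_ne_zero : ∀ x, β x ≠ 0
  kenmotsu : ∀ X Y : Π x : M, TangentSpace I x, CMDiff ∞ (T% X) → CMDiff ∞ (T% Y) → ∀ x,
    nablaEndo (fun y u ↦ f y u) X Y x
      = β x • ((inner ℝ (f x (X x)) (Y x) : ℝ) • xiBar ξ x - etaBar η x (Y x) • f x (X x))

end WeakKenmotsu

/-! Everything follows from `∇_X ξ_i = β P X`, where `P X = X - ∑ η^j(X) ξ_j`. The Kenmotsu equation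
with `Y = ξ_i` gives `f (∇_X ξ_i) = β f X`, and `ker f` is spanned by the `ξ_j`, so only the
components of `∇_X ξ_i` along the `ξ_j` remain. Normality makes every `η^m` invariant under the flow
of `ξ_i`, and this forces these components to vanish (`IsWeakKenmotsuF.cov_field`).

Differentiating once more gives `R_{X,Y} ξ_i` (`curv_xi`), and a trace gives `Ric♯ ξ_i`. For the
derivative of `Ric` the Lie derivative `L` along `ξ_i` is computed: `L ∇ = -2β² g(P·,·) ξ̄`
(`lie_cov`), hence `L R` (`lie_curv`), and by contraction `L Ric = -4nsβ³ g(P·,·)`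
(`IsWeakKenmotsuF.mvfderiv_ricci`). Since `[ξ_i, X] = ∇_{ξ_i} X - β P X`, this converts into a
formula for `∇_{ξ_i} Ric` (`IsWeakKenmotsuF.D_ricciFun`), whose trace is the formula for `ξ_i(r)`.

The tensor calculus takes place in an abstract module over a commutative ring, where identities
reduce to `module` and `ring`. Smooth vector fields are an instance (`lcAlg`), and
`curvatureAt_apply` carries the results to tangent vectors. -/

/-! ### Algebraic Levi-Civita calculus and the symmetries of the curvature. -/

/-- A metric Lie–Rinehart algebra with its Levi-Civita connection: the algebraic structure carried
by the vector fields `L` of a Riemannian manifold over the ring `R` of smooth functions. The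
bracket is the one determined by the (torsion free) connection. -/
structure MetricLieRinehart (R L : Type*) [CommRing R] [AddCommGroup L] [Module R L] where
  /-- The derivative of a function along a vector field. -/
  D : L →ₗ[R] Derivation ℤ R R
  /-- The metric. -/
  g : L →ₗ[R] L →ₗ[R] R
  /-- The Levi-Civita connection. -/
  cov : L →ₗ[R] L →+ L
  add_self_cancel : ∀ r : R, r + r = 0 → r = 0
  g_comm : ∀ X Y, g X Y = g Y X
  nondegenerate : ∀ X Y, (∀ Z, g X Z = g Y Z) → X = Y
  leibniz : ∀ X r Y, cov X (r • Y) = r • cov X Y + D X r • Y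
  metric : ∀ X Y Z, D X (g Y Z) = g (cov X Y) Z + g Y (cov X Z)
  D_bracket : ∀ X Y r, D (cov X Y - cov Y X) r = D X (D Y r) - D Y (D X r)
  jacobi : ∀ X Y Z, cov X (cov Y Z - cov Z Y) - cov (cov Y Z - cov Z Y) X =
    (cov (cov X Y - cov Y X) Z - cov Z (cov X Y - cov Y X))
      + (cov Y (cov X Z - cov Z X) - cov (cov X Z - cov Z X) Y)

namespace MetricLieRinehart

variable {R L : Type*} [CommRing R] [AddCommGroup L] [Module R L] (A : MetricLieRinehart R L)

/-- The Lie bracket. -/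
def bracket (X Y : L) : L := A.cov X Y - A.cov Y X

theorem bracket_def (X Y : L) : A.bracket X Y = A.cov X Y - A.cov Y X := rfl

/-- The curvature operator. -/
def curv (X Y Z : L) : L :=
  A.cov X (A.cov Y Z) - A.cov Y (A.cov X Z) - A.cov (A.bracket X Y) Z

theorem curv_def (X Y Z : L) :
    A.curv X Y Z = A.cov X (A.cov Y Z) - A.cov Y (A.cov X Z) - A.cov (A.bracket X Y) Z := rfl

theorem cov_add_left (X Y Z : L) : A.cov (X + Y) Z = A.cov X Z + A.cov Y Z := by simp

theorem cov_sub_left (X Y Z : L) : A.cov (X - Y) Z = A.cov X Z - A.cov Y Z := by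
  rw [map_sub]; rfl

theorem cov_add_right (X Y Z : L) : A.cov X (Y + Z) = A.cov X Y + A.cov X Z := map_add _ _ _

theorem cov_sub_right (X Y Z : L) : A.cov X (Y - Z) = A.cov X Y - A.cov X Z := map_sub _ _ _

theorem cov_smul_left (r : R) (X Z : L) : A.cov (r • X) Z = r • A.cov X Z := by
  rw [map_smul]; rfl

theorem bracket_jacobi (X Y Z : L) :
    A.bracket X (A.bracket Y Z) = A.bracket (A.bracket X Y) Z + A.bracket Y (A.bracket X Z) :=
  A.jacobi X Y Z

theorem D_bracket' (X Y : L) (r : R) :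
    A.D (A.bracket X Y) r = A.D X (A.D Y r) - A.D Y (A.D X r) := A.D_bracket X Y r

theorem curv_swap (X Y Z : L) : A.curv X Y Z = -A.curv Y X Z := by
  simp only [curv, bracket, cov_sub_left]
  abel

theorem bracket_smul_left (r : R) (X Y : L) :
    A.bracket (r • X) Y = r • A.bracket X Y - A.D Y r • X := by
  simp only [bracket, cov_smul_left, leibniz]
  module

theorem curv_add_left (X X' Y Z : L) : A.curv (X + X') Y Z = A.curv X Y Z + A.curv X' Y Z := by
  simp only [curv, bracket, cov_add_left, cov_sub_left, cov_add_right]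
  abel

theorem curv_smul_left (r : R) (X Y Z : L) : A.curv (r • X) Y Z = r • A.curv X Y Z := by
  simp only [curv, bracket_smul_left, cov_smul_left, cov_sub_left, leibniz]
  module

theorem curv_add_mid (X Y Y' Z : L) : A.curv X (Y + Y') Z = A.curv X Y Z + A.curv X Y' Z := by
  rw [curv_swap, curv_add_left, curv_swap A Y, curv_swap A Y']
  abel

theorem curv_smul_mid (r : R) (X Y Z : L) : A.curv X (r • Y) Z = r • A.curv X Y Z := by
  rw [curv_swap, curv_smul_left, curv_swap A Y, smul_neg, neg_neg]

theorem curv_add_right (X Y Z Z' : L) : A.curv X Y (Z + Z') = A.curv X Y Z + A.curv X Y Z' := by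
  simp only [curv, map_add]
  abel

/-- The second derivatives of `r` cancel because `D` sends brackets to commutators. -/
theorem curv_smul_right (r : R) (X Y Z : L) : A.curv X Y (r • Z) = r • A.curv X Y Z := by
  simp only [curv, leibniz, map_add, D_bracket']
  module

/-- Without torsion the cyclic sum, expanded in `cov`, is the Jacobi identity. -/
theorem bianchi (X Y Z : L) : A.curv X Y Z + A.curv Y Z X + A.curv Z X Y = 0 := by
  have := A.bracket_jacobi X Y Z
  simp only [curv, bracket, cov_sub_left, cov_sub_right] at this ⊢
  rw [← sub_eq_zero] at this
  rw [← this]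
  abel

/-- The commutator of derivatives applied to the function `g(Z, W)`, expanded by metric
compatibility. -/
theorem g_curv_skew (X Y Z W : L) : A.g (A.curv X Y Z) W = -A.g (A.curv X Y W) Z := by
  have := A.D_bracket' X Y (A.g Z W)
  simp only [metric, map_add] at this
  simp only [curv, map_sub, LinearMap.sub_apply]
  rw [A.g_comm (A.cov X (A.cov Y W)) Z, A.g_comm (A.cov Y (A.cov X W)) Z,
    A.g_comm (A.cov (A.bracket X Y) W)]
  linear_combination -this

theorem g_curv_pair (X Y Z W : L) : A.g (A.curv X Y Z) W = A.g (A.curv Z W X) Y := by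
  have b (X Y Z W : L) :
      A.g (A.curv X Y Z) W + A.g (A.curv Y Z X) W + A.g (A.curv Z X Y) W = 0 := by
    rw [← LinearMap.add_apply, ← map_add, ← LinearMap.add_apply, ← map_add, bianchi]
    simp
  have sw (X Y Z W : L) : A.g (A.curv X Y Z) W = -A.g (A.curv Y X Z) W := by
    rw [curv_swap]; simp
  -- The classical combination of four Bianchi identities yields twice the difference;
  -- `add_self_cancel` replaces division by 2 in `R`.
  have := A.add_self_cancel (A.g (A.curv X Y Z) W - A.g (A.curv Z W X) Y) <| by
    linear_combination b X Y Z W + b Y Z W X - b Z W X Y - b W X Y Z - A.g_curv_skew Y Z W X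
      - A.g_curv_skew Z W Y X + A.g_curv_skew W X Z Y + A.g_curv_skew X Y W Z
      + sw X Z W Y - A.g_curv_skew Z X W Y - sw W Y Z X + A.g_curv_skew Y W Z X
  exact sub_eq_zero.mp this

section Projection

variable {s : ℕ} (ξ : Fin s → L)

/-- The projection along the fields `ξ i`: `X - ∑ g(ξ_i, X) ξ_i`. -/
def proj (X : L) : L := X - ∑ i, A.g (ξ i) X • ξ i

/-- The dual form `∑ g(ξ_i, ·)`. -/
def etaSum (X : L) : R := ∑ i, A.g (ξ i) X

theorem proj_sub (X Y : L) : A.proj ξ (X - Y) = A.proj ξ X - A.proj ξ Y := by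
  simp only [proj, map_sub, sub_smul, Finset.sum_sub_distrib]
  abel

theorem g_proj (X Y : L) :
    A.g (A.proj ξ X) Y = A.g X Y - ∑ i, A.g (ξ i) X * A.g (ξ i) Y := by
  simp [proj, LinearMap.sum_apply]

theorem g_proj_comm (X Y : L) : A.g (A.proj ξ X) Y = A.g (A.proj ξ Y) X := by
  simp only [g_proj, A.g_comm X Y, mul_comm]

theorem etaSum_eq (X : L) : A.etaSum ξ X = A.g (∑ i, ξ i) X := by
  simp [etaSum, LinearMap.sum_apply]

end Projection

/-! ### Consequences of `∇_X ξ_i = b P X` with `b` constant. -/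

section Kenmotsu

variable {A} {s : ℕ} {ξ : Fin s → L} {b : R}

/-- Both factors of `g(ξ_i, Y) ξ_i` are differentiated with `hcov`; the correction term is `(∇_X P)
Y`. -/
theorem cov_proj (hcov : ∀ X i, A.cov X (ξ i) = b • A.proj ξ X)
    (X Y : L) : A.cov X (A.proj ξ Y) =
      A.proj ξ (A.cov X Y) - b • (A.g (A.proj ξ X) Y • ∑ i, ξ i + A.etaSum ξ Y • A.proj ξ X) := by
  have h (i) : A.cov X (A.g (ξ i) Y • ξ i) = A.g (ξ i) (A.cov X Y) • ξ i
      + b • (A.g (A.proj ξ X) Y • ξ i + A.g (ξ i) Y • A.proj ξ X) := by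
    rw [leibniz, metric, hcov]
    simp only [map_smul, LinearMap.smul_apply, smul_eq_mul]
    module
  rw [proj, cov_sub_right, map_sum]
  simp only [h, Finset.sum_add_distrib, ← Finset.smul_sum, ← Finset.sum_smul]
  simp only [proj, etaSum]
  module

/-- The curvature operator applied to a characteristic field. -/
theorem curv_xi (hb : ∀ X, A.D X b = 0)
    (hcov : ∀ X i, A.cov X (ξ i) = b • A.proj ξ X) (X Y : L) (i : Fin s) :
    A.curv X Y (ξ i) = b ^ 2 • (A.etaSum ξ X • A.proj ξ Y - A.etaSum ξ Y • A.proj ξ X) := by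
  rw [curv_def]
  -- The `P [X,Y]` terms cancel, and so do the multiples of `ξ̄`, as `g(P X, Y)` is symmetric.
  simp only [hcov, leibniz, hb, cov_proj hcov, bracket_def, proj_sub, A.g_proj_comm ξ X Y]
  module

/-- Pair symmetry moves `ξ i` to the third slot, where `curv_xi` applies. -/
theorem curv_xi_left (hb : ∀ X, A.D X b = 0)
    (hcov : ∀ X i, A.cov X (ξ i) = b • A.proj ξ X) (X Y : L) (i : Fin s) :
    A.curv (ξ i) X Y =
      b ^ 2 • (A.etaSum ξ Y • A.proj ξ X - A.g (A.proj ξ X) Y • ∑ i, ξ i) := by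
  refine A.nondegenerate _ _ fun Z ↦ ?_
  rw [g_curv_pair, curv_xi hb hcov]
  simp only [map_sub, map_smul, LinearMap.sub_apply, LinearMap.smul_apply, smul_eq_mul,
    ← etaSum_eq, A.g_proj_comm ξ X]
  ring

/-- The Lie derivative of the connection along a characteristic field. -/
theorem lie_cov (hb : ∀ X, A.D X b = 0)
    (hcov : ∀ X i, A.cov X (ξ i) = b • A.proj ξ X) (X Y : L) (i : Fin s) :
    A.bracket (ξ i) (A.cov X Y) = A.cov (A.bracket (ξ i) X) Y + A.cov X (A.bracket (ξ i) Y)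
      - (2 * b ^ 2 * A.g (A.proj ξ X) Y) • ∑ i, ξ i := by
  have h := curv_xi_left hb hcov X Y i
  rw [curv_def] at h
  -- The Lie derivative of the connection is `R(ξ_i, X) Y + ∇²_{X,Y} ξ_i`. The terms `η̄(Y) P X` of
  -- `h` and `h2` cancel, while those along `ξ̄` double.
  have h2 : A.cov X (A.cov Y (ξ i)) - A.cov (A.cov X Y) (ξ i) =
      -(b ^ 2) • (A.g (A.proj ξ X) Y • ∑ i, ξ i + A.etaSum ξ Y • A.proj ξ X) := by
    simp only [hcov, leibniz, hb, cov_proj hcov]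
    module
  rw [A.bracket_def (ξ i) (A.cov X Y), A.bracket_def (ξ i) Y, cov_sub_right]
  rw [← sub_eq_zero] at h h2 ⊢
  -- The two zeros are replaced by the left sides of `h` and `h2`, so that the goal becomes a formal
  -- identity.
  rw [← add_zero (0 : L)]
  nth_rewrite 1 [← h]
  nth_rewrite 1 [← h2]
  simp only [bracket_def A (ξ i), cov_sub_left]
  module

theorem cov_sum_xi (hcov : ∀ X i, A.cov X (ξ i) = b • A.proj ξ X)
    (X : L) : A.cov X (∑ i, ξ i) = (s * b) • A.proj ξ X := by
  simp [map_sum, hcov, mul_smul, Nat.cast_smul_eq_nsmul]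

theorem D_g_proj (hcov : ∀ X i, A.cov X (ξ i) = b • A.proj ξ X) (X Y Z : L) :
    A.D X (A.g (A.proj ξ Y) Z) = A.g (A.proj ξ (A.cov X Y)) Z + A.g (A.proj ξ Y) (A.cov X Z)
      - b * (A.g (A.proj ξ X) Y * A.etaSum ξ Z + A.etaSum ξ Y * A.g (A.proj ξ X) Z) := by
  rw [metric, cov_proj hcov]
  simp only [map_sub, map_add, map_smul, LinearMap.sub_apply, LinearMap.add_apply,
    LinearMap.smul_apply, smul_eq_mul, ← etaSum_eq]
  ring

/-- The Lie derivative of the curvature along a characteristic field, applied to vectors. -/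
def lieCurv (A : MetricLieRinehart R L) (ξ : Fin s → L) (b : R) (X Y Z : L) : L :=
  -(2 * b ^ 3) • ((s : R) • (A.g (A.proj ξ Y) Z • A.proj ξ X - A.g (A.proj ξ X) Z • A.proj ξ Y)
    - (A.etaSum ξ Y * A.g (A.proj ξ X) Z - A.etaSum ξ X * A.g (A.proj ξ Y) Z) • ∑ i, ξ i)

/-- With `S = L ∇ = -2b² g(P·,·) ξ̄`, the Lie derivative of the curvature is `(∇_X S)(Y,Z) - (∇_Y
S)(X,Z)`. The derivative of `g(P·,·)` comes from `D_g_proj`, and `∇_X ξ̄ = s b P X` produces the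
factor `s`. -/
theorem lie_curv (hb : ∀ X, A.D X b = 0)
    (hcov : ∀ X i, A.cov X (ξ i) = b • A.proj ξ X) (X Y Z : L) (i : Fin s) :
    A.bracket (ξ i) (A.curv X Y Z) = A.curv (A.bracket (ξ i) X) Y Z
      + A.curv X (A.bracket (ξ i) Y) Z + A.curv X Y (A.bracket (ξ i) Z)
      + A.lieCurv ξ b X Y Z := by
  have hc (X Y) : A.D X (2 * b ^ 2 * Y) = 2 * b ^ 2 * A.D X Y := by
    have h2 : A.D X 2 = 0 := by simpa using (A.D X).map_natCast 2
    simp [pow_two, hb, h2]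
  have hbs (X Y Z) : A.bracket X (Y - Z) = A.bracket X Y - A.bracket X Z := by
    simp only [bracket, cov_sub_left, cov_sub_right]; abel
  rw [curv_def, hbs, hbs]
  simp only [lie_cov hb hcov]
  rw [bracket_jacobi]
  simp only [curv_def, cov_add_left, cov_add_right, leibniz, hc,
    D_g_proj hcov, cov_sum_xi hcov, bracket_def A X Y, proj_sub, map_sub,
    LinearMap.sub_apply, lieCurv]
  rw [A.g_proj_comm ξ Y X]
  module

end Kenmotsu

end MetricLieRinehart

namespace WeakKenmotsu

set_option linter.unusedSectionVars false

/-! ### Smooth vector fields: brackets, global extensions, orthonormal frames. -/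

section SmoothFields

open scoped Topology
open Filter

variable {E : Type*} [NormedAddCommGroup E] [NormedSpace ℝ E] [FiniteDimensional ℝ E]
  {H : Type*} [TopologicalSpace H] {I : ModelWithCorners ℝ E H}
  {M : Type*} [TopologicalSpace M] [ChartedSpace H M] [IsManifold I ∞ M]

theorem contMDiff_mlieBracket {X Y : Π x : M, TangentSpace I x}
    (hX : CMDiff ∞ (T% X)) (hY : CMDiff ∞ (T% Y)) : CMDiff ∞ (T% (mlieBracket I X Y)) := by
  refine contMDiff_infty.2 fun m ↦ ?_
  have : IsManifold I ((m + 1 : ℕ∞) + 1) M := .of_le (n := ∞) (by exact_mod_cast le_top)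
  have : IsManifold I (minSmoothness ℝ 2) M :=
    .of_le (n := ∞) (by simpa using WithTop.coe_le_coe.2 (le_top : (2 : ℕ∞) ≤ ⊤))
  exact ContDiff.mlieBracket_vectorField (m := m) (n := m + 1) (hX.of_le (by exact_mod_cast le_top))
    (hY.of_le (by exact_mod_cast le_top)) (by simp)

theorem leibniz_mlieBracket {X Y Z : Π x : M, TangentSpace I x}
    (hX : CMDiff ∞ (T% X)) (hY : CMDiff ∞ (T% Y)) (hZ : CMDiff ∞ (T% Z)) :
    mlieBracket I X (mlieBracket I Y Z) =
      mlieBracket I (mlieBracket I X Y) Z + mlieBracket I Y (mlieBracket I X Z) := by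
  have : IsManifold I (minSmoothness ℝ 3) M := .of_le (n := ∞)
      (by simpa using WithTop.coe_le_coe.2 (le_top : (3 : ℕ∞) ≤ ⊤))
  have h : minSmoothness ℝ 2 ≤ (∞ : WithTop ℕ∞) := by simpa using WithTop.coe_le_coe.2 (le_top :
      (2 : ℕ∞) ≤ ⊤)
  exact leibniz_identity_mlieBracket (hX.of_le h) (hY.of_le h) (hZ.of_le h)

section Bump

variable [T2Space M]

theorem exists_bump {x : M} {U : Set M} (hU : U ∈ 𝓝 x) :
    ∃ χ : M → ℝ, CMDiff ∞ χ ∧ χ =ᶠ[𝓝 x] 1 ∧ tsupport χ ⊆ U := by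
  obtain ⟨φ, -, hφ⟩ := (SmoothBumpFunction.nhds_basis_tsupport (I := I) x).mem_iff.1 hU
  exact ⟨φ, φ.contMDiff, φ.eventuallyEq_one, hφ⟩

/-- Multiplication by a bump function makes a local field global without changing its germ, so local
frames can enter an algebra of global fields. -/
theorem exists_contMDiff_eventuallyEq {x : M} {σ : Π x : M, TangentSpace I x}
    (h : ∀ᶠ y in 𝓝 x, CMDiffAt ∞ (T% σ) y) :
    ∃ X : Π x : M, TangentSpace I x, CMDiff ∞ (T% X) ∧ ∀ᶠ y in 𝓝 x, X y = σ y := by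
  obtain ⟨U, hU, hUo, hxU⟩ := eventually_nhds_iff.1 h
  obtain ⟨χ, hχ, hχ1, hχU⟩ := exists_bump (I := I) (hUo.mem_nhds hxU)
  refine ⟨χ • σ, ContMDiffOn.smul_section_of_tsupport hχ.contMDiffOn hUo hχU
    fun y hy ↦ (hU y hy).contMDiffWithinAt, ?_⟩
  filter_upwards [hχ1] with y hy
  simp [hy]

theorem exists_contMDiff_extend {x : M} (u : TangentSpace I x) :
    ∃ X : Π x : M, TangentSpace I x, CMDiff ∞ (T% X) ∧
      ∀ᶠ y in 𝓝 x, X y = FiberBundle.extend E u y := by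
  obtain ⟨s, hs, h⟩ := FiberBundle.exists_contMDiffOn_extend (k := ∞) I E u
  refine exists_contMDiff_eventuallyEq ?_
  obtain ⟨U, hU, hUo, hxU⟩ := mem_nhds_iff.1 hs
  filter_upwards [hUo.mem_nhds hxU] with y hy
  exact h.contMDiffAt (mem_of_superset (hUo.mem_nhds hy) hU)

end Bump

/-- Smoothness of the derivative of a function along a field, by the Leibniz rule
`[X, f Z] = f [X, Z] + (X f) Z`. -/
theorem contMDiff_mvfderiv_apply [T2Space M] [RiemannianBundle (fun x : M ↦ TangentSpace I x)]
    [IsContMDiffRiemannianBundle I ∞ E (fun x : M ↦ TangentSpace I x)]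
    {X : Π x : M, TangentSpace I x} {f : M → ℝ}
    (hX : CMDiff ∞ (T% X)) (hf : CMDiff ∞ f) : CMDiff ∞ (fun x ↦ d% f x (X x)) := by
  intro x
  by_cases hx : ∃ u : TangentSpace I x, u ≠ 0
  · obtain ⟨u, hu⟩ := hx
    obtain ⟨Z, hZ, hZu⟩ := exists_contMDiff_extend u
    have hZx : Z x = u := by simpa using hZu.self_of_nhds
    have key (y : M) : mlieBracket I X (f • Z) y - f y • mlieBracket I X Z y
        = d% f y (X y) • Z y := by
      rw [mlieBracket_smul_right (hf.mdifferentiable (by simp) y)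
        (hZ.mdifferentiable (by simp) y)]
      simp
    -- The coefficient of `Z` is recovered as a quotient by `g(Z, Z)`, which is nonzero near `x`.
    have hs : CMDiff ∞ (fun y ↦ (inner ℝ (d% f y (X y) • Z y) (Z y) : ℝ)) := by
      refine ContMDiff.inner_bundle (F := E) (E := fun x : M ↦ TangentSpace I x) ?_ hZ
      simp_rw [← key]
      exact (contMDiff_mlieBracket hX (hf.smul_section hZ)).sub_section
        (hf.smul_section (contMDiff_mlieBracket hX hZ))
    have hZZ : CMDiff ∞ (fun y ↦ (inner ℝ (Z y) (Z y) : ℝ)) :=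
      ContMDiff.inner_bundle (F := E) (E := fun x : M ↦ TangentSpace I x) hZ hZ
    have h0 : (inner ℝ (Z x) (Z x) : ℝ) ≠ 0 := by simpa [hZx] using hu
    refine ((hs x).div₀ (hZZ x) h0).congr_of_eventuallyEq ?_
    filter_upwards [hZZ.continuous.continuousAt.eventually_ne h0] with y hy
    simp only [Pi.div_apply, real_inner_smul_left]
    field_simp
  -- If some tangent space is zero, then so is the model space `E`, and all fields vanish.
  · push Not at hx
    have : Subsingleton E := ⟨fun a b ↦ (hx a).trans (hx b).symm⟩
    have : (fun x ↦ d% f x (X x)) = fun _ ↦ (0 : ℝ) := by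
      funext y
      have : X y = 0 := Subsingleton.elim (α := E) _ _
      simp [this]
    rw [this]
    exact contMDiffAt_const

section Frame

variable [T2Space M] [RiemannianBundle (fun x : M ↦ TangentSpace I x)]
  [IsContMDiffRiemannianBundle I ∞ E (fun x : M ↦ TangentSpace I x)]

/-- Gram–Schmidt orthonormalization preserves smoothness of linearly independent fields. -/
theorem contMDiffAt_gramSchmidtNormed {m : ℕ} {e : Fin m → Π x : M, TangentSpace I x} {x : M}
    (he : ∀ i, CMDiffAt ∞ (T% (e i)) x) (hli : LinearIndependent ℝ (fun i ↦ e i x)) (i : Fin m) :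
    CMDiffAt ∞ (T% (fun y ↦ InnerProductSpace.gramSchmidtNormed ℝ (fun j ↦ e j y) i)) x := by
  have hin {X Y : Π x : M, TangentSpace I x} (hX : CMDiffAt ∞ (T% X) x)
      (hY : CMDiffAt ∞ (T% Y) x) : CMDiffAt ∞ (fun y ↦ (inner ℝ (X y) (Y y) : ℝ)) x :=
    ContMDiffAt.inner_bundle (F := E) (E := fun x : M ↦ TangentSpace I x) hX hY
  have h0 (j) : InnerProductSpace.gramSchmidt ℝ (fun j ↦ e j x) j ≠ 0 :=
    InnerProductSpace.gramSchmidt_ne_zero j hli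
  have hg (j : Fin m) :
      CMDiffAt ∞ (T% (fun y ↦ InnerProductSpace.gramSchmidt ℝ (fun j ↦ e j y) j)) x := by
    induction j using WellFoundedLT.induction with
    | _ j ih =>
      have h (y : M) : InnerProductSpace.gramSchmidt ℝ (fun j ↦ e j y) j = (e j - fun y ↦
          ∑ k ∈ Finset.Iio j,
            (fun y ↦ (inner ℝ (InnerProductSpace.gramSchmidt ℝ (fun j ↦ e j y) k) (e j y) : ℝ)
              / inner ℝ (InnerProductSpace.gramSchmidt ℝ (fun j ↦ e j y) k)
                (InnerProductSpace.gramSchmidt ℝ (fun j ↦ e j y) k)) y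
            • InnerProductSpace.gramSchmidt ℝ (fun j ↦ e j y) k) y := by
        have := InnerProductSpace.gramSchmidt_def'' ℝ (fun j ↦ e j y) j
        rw [Pi.sub_apply, eq_sub_iff_add_eq]
        simpa [real_inner_self_eq_norm_sq] using this.symm
      simp_rw [h]
      refine (he j).sub_section (ContMDiffAt.sum_section fun k hk ↦ ?_)
      have hk := ih k (Finset.mem_Iio.1 hk)
      exact ((hin hk (he j)).div₀ (hin hk hk) (by simpa using h0 k)).smul_section hk
  have h (y : M) : InnerProductSpace.gramSchmidtNormed ℝ (fun j ↦ e j y) i =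
      (fun y ↦ (Real.sqrt (inner ℝ (InnerProductSpace.gramSchmidt ℝ (fun j ↦ e j y) i)
        (InnerProductSpace.gramSchmidt ℝ (fun j ↦ e j y) i)))⁻¹) y
        • InnerProductSpace.gramSchmidt ℝ (fun j ↦ e j y) i := by
    rw [InnerProductSpace.gramSchmidtNormed, norm_eq_sqrt_real_inner]
    rfl
  simp_rw [h]
  have hpos : (inner ℝ (InnerProductSpace.gramSchmidt ℝ (fun j ↦ e j x) i)
      (InnerProductSpace.gramSchmidt ℝ (fun j ↦ e j x) i) : ℝ) ≠ 0 := by simpa using h0 i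
  refine ContMDiffAt.smul_section (ContMDiffAt.inv₀ ?_ ?_) (hg i)
  · exact ((Real.contDiffAt_sqrt hpos).contMDiffAt).comp x (hin (hg i) (hg i))
  · rw [Real.sqrt_ne_zero (by exact real_inner_self_nonneg)]
    exact hpos

/-- Near every point there is an orthonormal frame that consists of global smooth fields. -/
theorem exists_orthonormal_frame (x : M) :
    ∃ e : Fin (finrank ℝ E) → Π x : M, TangentSpace I x, (∀ a, CMDiff ∞ (T% (e a))) ∧
      ∀ᶠ y in 𝓝 x, Orthonormal ℝ (fun a ↦ e a y) := by
  let t := trivializationAt E (fun x : M ↦ TangentSpace I x) x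
  let b := finBasis ℝ E
  have hfr := t.isLocalFrameOn_localFrame_baseSet I ∞ b
  have hev : ∀ᶠ y in 𝓝 x, y ∈ t.baseSet :=
    t.open_baseSet.mem_nhds (FiberBundle.mem_baseSet_trivializationAt' x)
  have hsm (a) : ∀ᶠ y in 𝓝 x, CMDiffAt ∞ (T% (fun y ↦
      InnerProductSpace.gramSchmidtNormed ℝ (fun j ↦ t.localFrame b j y) a)) y := by
    filter_upwards [hev] with y hy
    exact contMDiffAt_gramSchmidtNormed (fun i ↦ hfr.contMDiffAt t.open_baseSet hy i)
      (hfr.linearIndependent hy) a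
  choose e he hee using fun a ↦ exists_contMDiff_eventuallyEq (hsm a)
  refine ⟨e, he, ?_⟩
  filter_upwards [hev, eventually_all.2 hee] with y hy h
  rw [funext h]
  exact InnerProductSpace.gramSchmidtNormed_orthonormal (hfr.linearIndependent hy)

end Frame

end SmoothFields

/-! ### Smooth fields as a metric Lie–Rinehart algebra. -/

section Algebra

open scoped Topology
open Filter

variable {E : Type*} [NormedAddCommGroup E] [NormedSpace ℝ E] [FiniteDimensional ℝ E]
  {H : Type*} [TopologicalSpace H] {I : ModelWithCorners ℝ E H}
  {M : Type*} [TopologicalSpace M] [ChartedSpace H M] [IsManifold I ∞ M]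

theorem exists_orthonormalBasis_eq [RiemannianBundle (fun x : M ↦ TangentSpace I x)] {x : M}
    {v : Fin (finrank ℝ E) → TangentSpace I x} (hv : Orthonormal ℝ v) :
    ∃ b : OrthonormalBasis (Fin (finrank ℝ E)) ℝ (TangentSpace I x), ⇑b = v := by
  have hc : Fintype.card (Fin (finrank ℝ E)) = finrank ℝ (TangentSpace I x) := by
    rw [Fintype.card_fin]; rfl
  refine ⟨OrthonormalBasis.mk hv ?_, OrthonormalBasis.coe_mk _ _⟩
  exact (hv.linearIndependent.span_eq_top_of_card_eq_finrank' hc).ge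

variable (I M) in
/-- The smooth vector fields. -/
abbrev SmoothField := Cₛ^∞⟮I; E, fun x : M ↦ TangentSpace I x⟯

variable (I M) in
/-- The smooth functions. -/
abbrev SmoothFun := C^∞⟮I, M; 𝓘(ℝ, ℝ), ℝ⟯

noncomputable instance : SMul (SmoothFun I M) (SmoothField I M) :=
  ⟨fun f X ↦ ⟨(f : M → ℝ) • (⇑X : Π x : M, TangentSpace I x), f.contMDiff.smul_section X.contMDiff⟩⟩

theorem smoothFun_smul_apply (f : SmoothFun I M) (X : SmoothField I M) (x : M) :
    (f • X) x = f x • X x := rfl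

theorem smoothField_sum_apply {ι : Type*} (t : Finset ι) (X : ι → SmoothField I M) (x : M) :
    (∑ i ∈ t, X i) x = ∑ i ∈ t, X i x := by
  rw [← ContMDiffSection.coeAddHom_apply, map_sum, Finset.sum_apply]
  rfl

theorem smoothFun_sum_apply {ι : Type*} (t : Finset ι) (f : ι → SmoothFun I M) (x : M) :
    (∑ i ∈ t, f i) x = ∑ i ∈ t, f i x := by
  rw [← ContMDiffMap.coeFnRingHom_apply, map_sum, Finset.sum_apply]
  rfl

noncomputable instance : Module (SmoothFun I M) (SmoothField I M) where
  one_smul X := by ext x; exact one_smul ℝ (X x)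
  mul_smul f g X := by ext x; exact mul_smul (f x) (g x) (X x)
  smul_zero f := by ext x; exact smul_zero (f x)
  smul_add f X Y := by ext x; exact smul_add (f x) (X x) (Y x)
  add_smul f g X := by ext x; exact add_smul (f x) (g x) (X x)
  zero_smul X := by ext x; exact zero_smul ℝ (X x)

variable [RiemannianBundle (fun x : M ↦ TangentSpace I x)]
  [IsContMDiffRiemannianBundle I ∞ E (fun x : M ↦ TangentSpace I x)]

theorem contMDiff_inner {X Y : Π x : M, TangentSpace I x} (hX : CMDiff ∞ (T% X))
    (hY : CMDiff ∞ (T% Y)) : CMDiff ∞ (fun y ↦ (inner ℝ (X y) (Y y) : ℝ)) :=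
  ContMDiff.inner_bundle (F := E) (E := fun x : M ↦ TangentSpace I x) hX hY

variable [T2Space M]

theorem contMDiff_koszul {X Y Z : Π x : M, TangentSpace I x} (hX : CMDiff ∞ (T% X))
    (hY : CMDiff ∞ (T% Y)) (hZ : CMDiff ∞ (T% Z)) : CMDiff ∞ (koszul X Y Z) := by
  have h1 := contMDiff_mvfderiv_apply hX (contMDiff_inner hY hZ)
  have h2 := contMDiff_mvfderiv_apply hY (contMDiff_inner hZ hX)
  have h3 := contMDiff_mvfderiv_apply hZ (contMDiff_inner hX hY)
  have h4 := contMDiff_inner (contMDiff_mlieBracket hX hY) hZ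
  have h5 := contMDiff_inner (contMDiff_mlieBracket hY hZ) hX
  have h6 := contMDiff_inner (contMDiff_mlieBracket hZ hX) hY
  exact contMDiff_const.mul (((((h1.add h2).sub h3).add h4).sub h5).add h6)

/-- The Levi-Civita connection preserves smoothness. -/
theorem contMDiff_leviCivita {X Y : Π x : M, TangentSpace I x} (hX : CMDiff ∞ (T% X))
    (hY : CMDiff ∞ (T% Y)) : CMDiff ∞ (T% (fun x ↦ leviCivita Y x (X x))) := by
  intro x
  obtain ⟨e, he, hon⟩ := exists_orthonormal_frame (I := I) x
  -- In a smooth orthonormal frame the components of `∇_X Y` are Koszul expressions, hence smooth.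
  have hs : CMDiffAt ∞ (T% (fun y ↦ ∑ a, koszul X Y (e a) y • e a y)) x :=
    ContMDiffAt.sum_section fun a _ ↦
      (contMDiff_koszul hX hY (he a) x).smul_section (he a x)
  refine hs.congr_of_eventuallyEq ?_
  filter_upwards [hon] with y hy
  obtain ⟨b, hb⟩ := exists_orthonormalBasis_eq hy
  congr 1
  rw [← b.sum_repr' (leviCivita Y y (X y))]
  refine Finset.sum_congr rfl fun a _ ↦ ?_
  rw [real_inner_comm, hb]
  congr 1
  exact inner_nabla_eq_koszul (hX.mdifferentiable (by simp) y) (hY.mdifferentiable (by simp) y)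
    ((he a).mdifferentiable (by simp) y)

/-- The derivative along a Lie bracket is the commutator of the derivatives: compare the Jacobi
identity for `X`, `Y`, `f Z` and for `X`, `Y`, `Z`. -/
theorem mvfderiv_mlieBracket {X Y : Π x : M, TangentSpace I x} {f : M → ℝ}
    (hX : CMDiff ∞ (T% X)) (hY : CMDiff ∞ (T% Y)) (hf : CMDiff ∞ f) (x : M) :
    d% f x (mlieBracket I X Y x) =
      d% (fun y ↦ d% f y (Y y)) x (X x) - d% (fun y ↦ d% f y (X y)) x (Y x) := by
  by_cases hx : ∃ u : TangentSpace I x, u ≠ 0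
  · obtain ⟨u, hu⟩ := hx
    obtain ⟨Z, hZ, hZu⟩ := exists_contMDiff_extend u
    have hZx : Z x ≠ 0 := by rwa [show Z x = u by simpa using hZu.self_of_nhds]
    have key {X Z : Π x : M, TangentSpace I x} {f : M → ℝ} (hf : CMDiff ∞ f)
        (hZ : CMDiff ∞ (T% Z)) : mlieBracket I X (f • Z) =
          (fun y ↦ d% f y (X y)) • Z + f • mlieBracket I X Z := by
      funext y
      exact mlieBracket_smul_right (hf.mdifferentiable (by simp) y)
        (hZ.mdifferentiable (by simp) y)
    have add {X Z Z' : Π x : M, TangentSpace I x} (hZ : CMDiff ∞ (T% Z))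
        (hZ' : CMDiff ∞ (T% Z')) : mlieBracket I X (Z + Z') =
          mlieBracket I X Z + mlieBracket I X Z' := by
      funext y
      exact mlieBracket_add_right (hZ.mdifferentiable (by simp) y)
        (hZ'.mdifferentiable (by simp) y)
    have hXf := contMDiff_mvfderiv_apply hX hf
    have hYf := contMDiff_mvfderiv_apply hY hf
    have hXZ := contMDiff_mlieBracket hX hZ
    have hYZ := contMDiff_mlieBracket hY hZ
    have h1 := congrFun (leibniz_mlieBracket hX hY (hf.smul_section hZ)) x
    have h2 := congrFun (leibniz_mlieBracket hX hY hZ) x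
    rw [key hf hZ, key hf hZ, key hf hZ, add (hYf.smul_section hZ) (hf.smul_section hYZ),
      add (hXf.smul_section hZ) (hf.smul_section hXZ), key hYf hZ, key hf hYZ, key hXf hZ,
      key hf hXZ] at h1
    simp only [Pi.add_apply, Pi.smul_apply', h2] at h1
    -- After the Jacobi identity for `Z` is substituted, only multiples of `Z x` survive, and `Z x ≠
    -- 0`.
    have h3 : (d% f x (mlieBracket I X Y x) - (d% (fun y ↦ d% f y (Y y)) x (X x)
        - d% (fun y ↦ d% f y (X y)) x (Y x))) • Z x = 0 := by
      rw [← sub_eq_zero] at h1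
      rw [← neg_eq_zero, ← h1]
      module
    exact sub_eq_zero.1 ((smul_eq_zero.1 h3).resolve_right hZx)
  · push Not at hx
    simp [hx]

/-- The covariant derivative of smooth fields. -/
noncomputable def covField (X Y : SmoothField I M) : SmoothField I M :=
  ⟨fun x ↦ leviCivita Y x (X x), contMDiff_leviCivita X.contMDiff Y.contMDiff⟩

/-- The Lie bracket of smooth fields. -/
noncomputable def bracketField (X Y : SmoothField I M) : SmoothField I M :=
  ⟨mlieBracket I X Y, contMDiff_mlieBracket X.contMDiff Y.contMDiff⟩

theorem covField_sub (X Y : SmoothField I M) :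
    covField X Y - covField Y X = bracketField X Y := by
  ext x
  exact leviCivita_torsion (X.mdifferentiable x) (Y.mdifferentiable x)

variable (I M) in
/-- The smooth functions and vector fields of a Riemannian manifold. -/
noncomputable def lcAlg :
    MetricLieRinehart (SmoothFun I M) (SmoothField I M) :=
  have hm (X : SmoothField I M) (x : M) : MDiffAt (T% fun x ↦ X x) x := X.mdifferentiable x
  have hf (f : SmoothFun I M) (x : M) : MDiffAt f x := f.contMDiff.mdifferentiable (by simp) x
  { D :=
    { toFun X := .mk' (AddMonoidHom.toIntLinearMap
        { toFun f := ⟨fun x ↦ d% f x (X x), contMDiff_mvfderiv_apply X.contMDiff f.contMDiff⟩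
          map_add' f g := by
            ext x
            exact congr($(mvfderiv_add (hf f x) (hf g x)) (X x))
          map_zero' := by
            ext x
            exact congr($(mvfderiv_const (I := I) (0 : ℝ)) (X x)) }) fun f g ↦ by
        ext x
        exact congr($(mvfderiv_mul (hf f x) (hf g x)) (X x))
      map_add' X Y := by
        ext f x
        exact map_add (d% f x) (X x) (Y x)
      map_smul' r X := by
        ext f x
        exact map_smul (d% f x) (r x) (X x) }
    g := LinearMap.mk₂ _ (fun X Y ↦ ⟨fun x ↦ inner ℝ (X x) (Y x),
        contMDiff_inner X.contMDiff Y.contMDiff⟩)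
      (fun X Y Z ↦ by ext x; exact inner_add_left (X x) (Y x) (Z x))
      (fun r X Y ↦ by ext x; exact real_inner_smul_left (X x) (Y x) (r x))
      (fun X Y Z ↦ by ext x; exact inner_add_right (X x) (Y x) (Z x))
      (fun r X Y ↦ by ext x; exact real_inner_smul_right (X x) (Y x) (r x))
    cov :=
    { toFun X :=
        { toFun Y := covField X Y
          map_zero' := by
            ext x
            exact congr($(leviCivita.zero) x (X x))
          map_add' Y Z := by
            ext x
            exact congr($(leviCivita.isCovariantDerivativeOn.add (hm Y x) (hm Z x)) (X x)) }
      map_add' X Y := by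
        ext Z x
        exact map_add (leviCivita Z x) (X x) (Y x)
      map_smul' r X := by
        ext Z x
        exact map_smul (leviCivita Z x) (r x) (X x) }
    add_self_cancel r hr := by
      ext x
      have : r x + r x = 0 := congr($hr x)
      change r x = 0
      linarith
    g_comm X Y := by
      ext x
      exact real_inner_comm (Y x) (X x)
    nondegenerate X Y h := by
      ext x
      refine ext_inner_right ℝ fun w ↦ ?_
      obtain ⟨Z, hZ, hZw⟩ := exists_contMDiff_extend w
      have : Z x = w := by simpa using hZw.self_of_nhds
      rw [← this]
      exact congr($(h ⟨Z, hZ⟩) x)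
    leibniz X r Y := by
      ext x
      exact congr($(leviCivita.isCovariantDerivativeOn.leibniz (hm Y x) (hf r x)) (X x))
    metric X Y Z := by
      ext x
      exact leviCivita_metric (hm X x) (hm Y x) (hm Z x)
    D_bracket X Y r := by
      ext x
      refine Eq.trans ?_ (mvfderiv_mlieBracket X.contMDiff Y.contMDiff r.contMDiff x)
      exact congr(d% r x $(leviCivita_torsion (hm X x) (hm Y x)))
    jacobi X Y Z := by
      change covField X (covField Y Z - covField Z Y) - covField (covField Y Z - covField Z Y) X =
        covField (covField X Y - covField Y X) Z - covField Z (covField X Y - covField Y X)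
        + (covField Y (covField X Z - covField Z X) - covField (covField X Z - covField Z X) Y)
      simp only [covField_sub]
      ext x
      exact congrFun (leibniz_mlieBracket X.contMDiff Y.contMDiff Z.contMDiff) x }

end Algebra

/-! ### From fields to tangent vectors: locality and tensoriality. -/

section Pointwise

open scoped Topology
open Filter

variable {E : Type*} [NormedAddCommGroup E] [NormedSpace ℝ E] [FiniteDimensional ℝ E]
  {H : Type*} [TopologicalSpace H] {I : ModelWithCorners ℝ E H}
  {M : Type*} [TopologicalSpace M] [ChartedSpace H M] [IsManifold I ∞ M]
  [RiemannianBundle (fun x : M ↦ TangentSpace I x)]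
  [IsContMDiffRiemannianBundle I ∞ E (fun x : M ↦ TangentSpace I x)] [T2Space M]

theorem lcAlg_D_apply (X : SmoothField I M) (f : SmoothFun I M) (x : M) :
    (lcAlg I M).D X f x = d% f x (X x) := rfl

theorem lcAlg_cov_apply (X Y : SmoothField I M) (x : M) :
    (lcAlg I M).cov X Y x = leviCivita Y x (X x) := rfl

theorem lcAlg_bracket (X Y : SmoothField I M) :
    (lcAlg I M).bracket X Y = bracketField X Y := covField_sub X Y

theorem lcAlg_curv_apply (X Y Z : SmoothField I M) (x : M) :
    (lcAlg I M).curv X Y Z x = curvature X Y Z x := by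
  rw [MetricLieRinehart.curv_def, lcAlg_bracket]
  rfl

theorem exists_smoothField_extend {x : M} (u : TangentSpace I x) :
    ∃ X : SmoothField I M, X x = u ∧ ∀ᶠ y in 𝓝 x, X y = FiberBundle.extend E u y := by
  obtain ⟨X, hX, h⟩ := exists_contMDiff_extend u
  exact ⟨⟨X, hX⟩, by simpa using h.self_of_nhds, h⟩

theorem mdifferentiableAt_of_eventuallyEq {x : M} {X : Π x : M, TangentSpace I x}
    {X' : SmoothField I M} (h : ∀ᶠ y in 𝓝 x, X y = X' y) : MDiffAt (T% X) x := by
  refine (X'.mdifferentiable x).congr_of_eventuallyEq ?_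
  filter_upwards [h] with y hy
  rw [hy]

theorem leviCivita_congr {x : M} {X : Π x : M, TangentSpace I x} {X' : SmoothField I M}
    (h : ∀ᶠ y in 𝓝 x, X y = X' y) : leviCivita X x = leviCivita X' x :=
  leviCivita.isCovariantDerivativeOnUniv.congr_of_eventuallyEq
    (mdifferentiableAt_of_eventuallyEq h) (X'.mdifferentiable x) univ_mem h

/-- The extensions used by `curvatureAt` are smooth only near `x`; here they are exchanged for
global fields with the same germs. -/
theorem curvature_congr {x : M} {X Y Z : Π x : M, TangentSpace I x} {X' Y' Z' : SmoothField I M}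
    (hX : ∀ᶠ y in 𝓝 x, X y = X' y) (hY : ∀ᶠ y in 𝓝 x, Y y = Y' y)
    (hZ : ∀ᶠ y in 𝓝 x, Z y = Z' y) : curvature X Y Z x = (lcAlg I M).curv X' Y' Z' x := by
  have h {Y : Π x : M, TangentSpace I x} {Y' : SmoothField I M}
      (hY : ∀ᶠ y in 𝓝 x, Y y = Y' y) :
      ∀ᶠ y in 𝓝 x, leviCivita Z y (Y y) = (lcAlg I M).cov Y' Z' y := by
    filter_upwards [hY, hZ.eventually_nhds] with y hy hz
    rw [leviCivita_congr hz, hy, lcAlg_cov_apply]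
  have hb : mlieBracket I X Y x = mlieBracket I X' Y' x :=
      EventuallyEq.mlieBracket_vectorField_eq hX hY
  rw [lcAlg_curv_apply, curvature, curvature, leviCivita_congr (h hY),
    leviCivita_congr (h hX), leviCivita_congr hZ, hb, hX.self_of_nhds, hY.self_of_nhds]
  rfl

/-- The value at `x` of a field that depends `C^∞`-linearly on a field `X` depends on `X x` only. -/
theorem apply_eq_zero_of_linear (T : SmoothField I M →ₗ[SmoothFun I M] SmoothField I M)
    {X : SmoothField I M} {x : M} (hX : X x = 0) : T X x = 0 := by
  obtain ⟨e, he, hon⟩ := exists_orthonormal_frame (I := I) x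
  obtain ⟨χ, hχ, hχ1, hχU⟩ := exists_bump (I := I) hon
  let χ' : SmoothFun I M := ⟨χ, hχ⟩
  let e' (a) : SmoothField I M := ⟨e a, he a⟩
  -- The cutoff `χ` is supported where the frame is orthonormal, so this expansion holds on all of
  -- `M`. Applying `T` at `x` leaves coefficients that vanish with `X x`.
  have h : χ' • X = ∑ a, (χ' * (lcAlg I M).g (e' a) X) • e' a := by
    ext y
    rw [smoothField_sum_apply]
    by_cases hy : χ y = 0
    · have (f : SmoothFun I M) : (χ' * f) y = 0 := by
        change χ y * f y = 0
        rw [hy, zero_mul]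
      simp only [smoothFun_smul_apply, this, zero_smul, Finset.sum_const_zero]
      exact (congrArg (· • X y) hy).trans (zero_smul _ _)
    · obtain ⟨b, hb⟩ := exists_orthonormalBasis_eq (hχU (subset_tsupport _ hy))
      rw [smoothFun_smul_apply]
      nth_rewrite 1 [← b.sum_repr' (X y)]
      rw [Finset.smul_sum, hb]
      exact Finset.sum_congr rfl fun a _ ↦ smul_smul _ _ _
  have h2 := congr($(congrArg T h) x)
  have h1 : χ' x = 1 := hχ1.self_of_nhds
  have h0 (a) : (χ' * (lcAlg I M).g (e' a) X) x = 0 := by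
    change χ' x * inner ℝ (e' a x) (X x) = 0
    rw [hX, inner_zero_right, mul_zero]
  rw [map_smul, map_sum, smoothField_sum_apply, smoothFun_smul_apply, h1, one_smul] at h2
  simpa only [map_smul, smoothFun_smul_apply, h0, zero_smul, Finset.sum_const_zero] using h2

theorem apply_congr_of_linear (T : SmoothField I M →ₗ[SmoothFun I M] SmoothField I M)
    {X Y : SmoothField I M} {x : M} (h : X x = Y x) : T X x = T Y x := by
  rw [← sub_eq_zero]
  have : (X - Y) x = 0 := sub_eq_zero.2 h
  simpa using apply_eq_zero_of_linear T this

theorem curv_congr {X Y Z X' Y' Z' : SmoothField I M} {x : M} (hX : X x = X' x)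
    (hY : Y x = Y' x) (hZ : Z x = Z' x) : (lcAlg I M).curv X Y Z x =
        (lcAlg I M).curv X' Y' Z' x := by
  refine (apply_congr_of_linear ⟨⟨fun X ↦ (lcAlg I M).curv X Y Z, fun _ _ ↦
      (lcAlg I M).curv_add_left ..⟩,
    fun _ _ ↦ (lcAlg I M).curv_smul_left ..⟩ hX).trans ?_
  refine (apply_congr_of_linear ⟨⟨fun Y ↦ (lcAlg I M).curv X' Y Z, fun _ _ ↦
      (lcAlg I M).curv_add_mid ..⟩,
    fun _ _ ↦ (lcAlg I M).curv_smul_mid ..⟩ hY).trans ?_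
  exact apply_congr_of_linear ⟨⟨fun Z ↦ (lcAlg I M).curv X' Y' Z, fun _ _ ↦
      (lcAlg I M).curv_add_right ..⟩,
    fun _ _ ↦ (lcAlg I M).curv_smul_right ..⟩ hZ

/-- The bridge to the algebra: tangent vectors are values of smooth fields, so every identity for
`curv` holds for `curvatureAt`. -/
theorem curvatureAt_apply (X Y Z : SmoothField I M) (x : M) :
    curvatureAt x (X x) (Y x) (Z x) = (lcAlg I M).curv X Y Z x := by
  obtain ⟨X', hX, hX'⟩ := exists_smoothField_extend (X x)
  obtain ⟨Y', hY, hY'⟩ := exists_smoothField_extend (Y x)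
  obtain ⟨Z', hZ, hZ'⟩ := exists_smoothField_extend (Z x)
  rw [← curv_congr hX hY hZ]
  exact curvature_congr (hX'.mono fun _ h ↦ h.symm) (hY'.mono fun _ h ↦ h.symm)
    (hZ'.mono fun _ h ↦ h.symm)

end Pointwise

/-! ### Symmetry, basis independence and smoothness of the Ricci tensor. -/

section Ricci

open scoped Topology
open Filter

variable {E : Type*} [NormedAddCommGroup E] [NormedSpace ℝ E] [FiniteDimensional ℝ E]
  {H : Type*} [TopologicalSpace H] {I : ModelWithCorners ℝ E H}
  {M : Type*} [TopologicalSpace M] [ChartedSpace H M] [IsManifold I ∞ M]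
  [RiemannianBundle (fun x : M ↦ TangentSpace I x)]
  [IsContMDiffRiemannianBundle I ∞ E (fun x : M ↦ TangentSpace I x)] [T2Space M]

theorem exists_smoothField {x : M} (u : TangentSpace I x) : ∃ X : SmoothField I M, X x = u :=
  let ⟨X, h, _⟩ := exists_smoothField_extend u
  ⟨X, h⟩

theorem curvatureAt_add_left {x : M} (u u' v w : TangentSpace I x) :
    curvatureAt x (u + u') v w = curvatureAt x u v w + curvatureAt x u' v w := by
  obtain ⟨X, rfl⟩ := exists_smoothField u
  obtain ⟨X', rfl⟩ := exists_smoothField u'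
  obtain ⟨Y, rfl⟩ := exists_smoothField v
  obtain ⟨Z, rfl⟩ := exists_smoothField w
  rw [curvatureAt_apply, curvatureAt_apply, ← Pi.add_apply, ← Pi.add_apply,
    ← ContMDiffSection.coe_add, ← ContMDiffSection.coe_add, ← MetricLieRinehart.curv_add_left,
    curvatureAt_apply]

theorem curvatureAt_swap {x : M} (u v w : TangentSpace I x) :
    curvatureAt x u v w = -curvatureAt x v u w := by
  obtain ⟨X, rfl⟩ := exists_smoothField u
  obtain ⟨Y, rfl⟩ := exists_smoothField v
  obtain ⟨Z, rfl⟩ := exists_smoothField w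
  rw [curvatureAt_apply, curvatureAt_apply, MetricLieRinehart.curv_swap]
  rfl

theorem smoothField_const_smul (c : ℝ) (X : SmoothField I M) (x : M) :
    ((ContMDiffMap.const c : SmoothFun I M) • X) x = c • X x := rfl

theorem curvatureAt_smul_left {x : M} (c : ℝ) (u v w : TangentSpace I x) :
    curvatureAt x (c • u) v w = c • curvatureAt x u v w := by
  obtain ⟨X, rfl⟩ := exists_smoothField u
  obtain ⟨Y, rfl⟩ := exists_smoothField v
  obtain ⟨Z, rfl⟩ := exists_smoothField w
  rw [curvatureAt_apply, ← smoothField_const_smul, ← smoothField_const_smul,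
    ← MetricLieRinehart.curv_smul_left, curvatureAt_apply]

theorem curvatureAt_add_right {x : M} (u v w w' : TangentSpace I x) :
    curvatureAt x u v (w + w') = curvatureAt x u v w + curvatureAt x u v w' := by
  obtain ⟨X, rfl⟩ := exists_smoothField u
  obtain ⟨Y, rfl⟩ := exists_smoothField v
  obtain ⟨Z, rfl⟩ := exists_smoothField w
  obtain ⟨Z', rfl⟩ := exists_smoothField w'
  rw [curvatureAt_apply, curvatureAt_apply, ← Pi.add_apply, ← Pi.add_apply,
    ← ContMDiffSection.coe_add, ← ContMDiffSection.coe_add, ← MetricLieRinehart.curv_add_right,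
    curvatureAt_apply]

theorem curvatureAt_smul_right {x : M} (c : ℝ) (u v w : TangentSpace I x) :
    curvatureAt x u v (c • w) = c • curvatureAt x u v w := by
  obtain ⟨X, rfl⟩ := exists_smoothField u
  obtain ⟨Y, rfl⟩ := exists_smoothField v
  obtain ⟨Z, rfl⟩ := exists_smoothField w
  rw [curvatureAt_apply, ← smoothField_const_smul, ← smoothField_const_smul,
    ← MetricLieRinehart.curv_smul_right, curvatureAt_apply]

theorem inner_curvatureAt_skew {x : M} (u v w z : TangentSpace I x) :
    (inner ℝ (curvatureAt x u v w) z : ℝ) = -inner ℝ (curvatureAt x u v z) w := by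
  obtain ⟨X, rfl⟩ := exists_smoothField u
  obtain ⟨Y, rfl⟩ := exists_smoothField v
  obtain ⟨Z, rfl⟩ := exists_smoothField w
  obtain ⟨W, rfl⟩ := exists_smoothField z
  rw [curvatureAt_apply, curvatureAt_apply]
  exact congr($((lcAlg I M).g_curv_skew X Y Z W) x)

theorem inner_curvatureAt_pair {x : M} (u v w z : TangentSpace I x) :
    (inner ℝ (curvatureAt x u v w) z : ℝ) = inner ℝ (curvatureAt x w z u) v := by
  obtain ⟨X, rfl⟩ := exists_smoothField u
  obtain ⟨Y, rfl⟩ := exists_smoothField v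
  obtain ⟨Z, rfl⟩ := exists_smoothField w
  obtain ⟨W, rfl⟩ := exists_smoothField z
  rw [curvatureAt_apply, curvatureAt_apply]
  exact congr($((lcAlg I M).g_curv_pair X Y Z W) x)

/-- The linear map `z ↦ R_{z,u} v`, whose trace is the Ricci tensor. -/
noncomputable def jacobiOp (x : M) (u v : TangentSpace I x) :
    TangentSpace I x →ₗ[ℝ] TangentSpace I x where
  toFun z := curvatureAt x z u v
  map_add' _ _ := curvatureAt_add_left ..
  map_smul' _ _ := curvatureAt_smul_left ..

theorem sum_inner_eq_trace {V ι : Type*} [NormedAddCommGroup V] [InnerProductSpace ℝ V]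
    [FiniteDimensional ℝ V] [Fintype ι] (b : OrthonormalBasis ι ℝ V) (T : V →ₗ[ℝ] V) :
    ∑ a, (inner ℝ (T (b a)) (b a) : ℝ) = LinearMap.trace ℝ V T := by
  rw [LinearMap.trace_eq_sum_inner T b]
  exact Finset.sum_congr rfl fun a _ ↦ real_inner_comm _ _

/-- `frame x` is chosen separately at each point. The trace allows any orthonormal basis instead, in
particular the values of a smooth frame. -/
theorem ricci_eq_trace (x : M) (u v : TangentSpace I x) :
    ricci x u v = LinearMap.trace ℝ _ (jacobiOp x u v) :=
  sum_inner_eq_trace (frame x) (jacobiOp x u v)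

theorem ricci_eq_sum {ι : Type*} [Fintype ι] {x : M}
    (b : OrthonormalBasis ι ℝ (TangentSpace I x)) (u v : TangentSpace I x) :
    ricci x u v = ∑ a, inner ℝ (curvatureAt x (b a) u v) (b a) := by
  rw [ricci_eq_trace, ← sum_inner_eq_trace b]
  rfl

/-- Holds termwise: pair symmetry, followed by two sign changes. -/
theorem ricci_comm {x : M} (u v : TangentSpace I x) : ricci x u v = ricci x v u := by
  refine Finset.sum_congr rfl fun a _ ↦ ?_
  rw [inner_curvatureAt_pair, curvatureAt_swap, inner_neg_left, inner_curvatureAt_skew, neg_neg]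

theorem ricci_add_right {x : M} (u v v' : TangentSpace I x) :
    ricci x u (v + v') = ricci x u v + ricci x u v' := by
  simp only [ricci, curvatureAt_add_right, inner_add_left, Finset.sum_add_distrib]

theorem ricci_smul_right {x : M} (c : ℝ) (u v : TangentSpace I x) :
    ricci x u (c • v) = c * ricci x u v := by
  simp only [ricci, curvatureAt_smul_right, real_inner_smul_left, Finset.mul_sum]

/-- The Ricci operator as a linear map. -/
noncomputable def ricciLin (x : M) : TangentSpace I x →ₗ[ℝ] TangentSpace I x where
  toFun := ricciOp x
  map_add' u v := by
    simp only [ricciOp, ricci_comm (u + v), ricci_add_right, add_smul, Finset.sum_add_distrib,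
      ricci_comm _ u, ricci_comm _ v]
  map_smul' c u := by
    simp only [ricciOp, ricci_comm (c • u), ricci_smul_right, mul_smul, Finset.smul_sum,
      ricci_comm _ u, RingHom.id_apply]

theorem inner_ricciLin (x : M) (u v : TangentSpace I x) :
    (inner ℝ (ricciLin x u) v : ℝ) = ricci x u v := by
  let φ : TangentSpace I x →ₗ[ℝ] ℝ :=
    ⟨⟨fun w ↦ ricci x u w, ricci_add_right u⟩, fun c w ↦ ricci_smul_right c u w⟩
  change inner ℝ (ricciOp x u) v = φ v
  conv_rhs => rw [← (frame x).sum_repr' v, map_sum]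
  rw [ricciOp, sum_inner]
  refine Finset.sum_congr rfl fun a _ ↦ ?_
  rw [real_inner_smul_left, map_smul, smul_eq_mul, mul_comm]
  rfl

theorem ricciOp_eq_sum {ι : Type*} [Fintype ι] {x : M}
    (b : OrthonormalBasis ι ℝ (TangentSpace I x)) (u : TangentSpace I x) :
    ricciOp x u = ∑ a, ricci x u (b a) • b a := by
  change ricciLin x u = _
  rw [← b.sum_repr' (ricciLin x u)]
  refine Finset.sum_congr rfl fun a _ ↦ ?_
  rw [real_inner_comm, inner_ricciLin]

theorem scalarCurvature_eq_trace (x : M) :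
    scalarCurvature I x = LinearMap.trace ℝ (TangentSpace I x) (ricciLin x) := by
  rw [← sum_inner_eq_trace (frame x)]
  simp only [inner_ricciLin, scalarCurvature]

theorem contMDiff_ricci (Y Z : SmoothField I M) : CMDiff ∞ (fun x ↦ ricci x (Y x) (Z x)) := by
  intro x
  obtain ⟨e, he, hon⟩ := exists_orthonormal_frame (I := I) x
  let e' (a) : SmoothField I M := ⟨e a, he a⟩
  refine ((∑ a, (lcAlg I M).g ((lcAlg I M).curv (e' a) Y Z) (e' a) : SmoothFun I M).contMDiff x
    ).congr_of_eventuallyEq ?_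
  filter_upwards [hon] with y hy
  obtain ⟨b, hb⟩ := exists_orthonormalBasis_eq hy
  rw [ricci_eq_sum b, smoothFun_sum_apply, hb]
  exact Finset.sum_congr rfl fun a _ ↦
    congr(inner ℝ $(curvatureAt_apply (e' a) Y Z y) (e a y))

/-- The Ricci tensor evaluated on two smooth fields. -/
noncomputable def ricciFun (Y Z : SmoothField I M) : SmoothFun I M :=
  ⟨fun x ↦ ricci x (Y x) (Z x), contMDiff_ricci Y Z⟩

theorem contMDiff_ricciOp (X : SmoothField I M) : CMDiff ∞ (T% fun x ↦ ricciOp x (X x)) := by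
  intro x
  obtain ⟨e, he, hon⟩ := exists_orthonormal_frame (I := I) x
  let e' (a) : SmoothField I M := ⟨e a, he a⟩
  refine ((∑ a, ricciFun X (e' a) • e' a : SmoothField I M).contMDiff x
    ).congr_of_eventuallyEq ?_
  filter_upwards [hon] with y hy
  obtain ⟨b, hb⟩ := exists_orthonormalBasis_eq hy
  congr 1
  rw [ricciOp_eq_sum b, smoothField_sum_apply, hb]
  rfl

theorem contMDiff_scalarCurvature : CMDiff ∞ (scalarCurvature I (M := M)) := by
  intro x
  obtain ⟨e, he, hon⟩ := exists_orthonormal_frame (I := I) x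
  let e' (a) : SmoothField I M := ⟨e a, he a⟩
  refine ((∑ a, ricciFun (e' a) (e' a) : SmoothFun I M).contMDiff x).congr_of_eventuallyEq ?_
  filter_upwards [hon] with y hy
  obtain ⟨b, hb⟩ := exists_orthonormalBasis_eq hy
  rw [scalarCurvature_eq_trace, ← sum_inner_eq_trace b, smoothFun_sum_apply, hb]
  simp only [inner_ricciLin]
  rfl

end Ricci

/-! ### The identity `∇_X ξ_i = β P X` on a weak Kenmotsu manifold. -/

section Structure

variable {E : Type*} [NormedAddCommGroup E] [NormedSpace ℝ E] [FiniteDimensional ℝ E]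
  {H : Type*} [TopologicalSpace H] {I : ModelWithCorners ℝ E H}
  {M : Type*} [TopologicalSpace M] [ChartedSpace H M] [IsManifold I ∞ M]
  [RiemannianBundle (fun x : M ↦ TangentSpace I x)]
  {n s : ℕ} {f Q : Π x : M, TangentSpace I x →L[ℝ] TangentSpace I x}
  {ξ : Fin s → Π x : M, TangentSpace I x} {η : Fin s → Π x : M, TangentSpace I x →L[ℝ] ℝ}

/-- `f² ξ_i = -ξ_i + ξ_i = 0`, so `f³ + f Q = 0` reduces to `f ξ_i = 0`. -/
theorem IsFramedWeakF.f_ξ (h : IsFramedWeakF n s f Q ξ η) (x : M) (i : Fin s) :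
    f x (ξ i x) = 0 := by
  have h0 : f x (f x (ξ i x)) = 0 := by
    rw [h.sq, h.Q_ξ]
    simp [h.η_ξ]
  simpa [h0, h.Q_ξ] using h.cube x (ξ i x)

/-- Removing the `ξ`-components of `u` does not change `f u` and puts `u` into the invariant
distribution. -/
theorem IsFramedWeakF.η_f (h : IsFramedWeakF n s f Q ξ η) (x : M) (i : Fin s)
    (u : TangentSpace I x) : η i x (f x u) = 0 := by
  have h1 := h.invariant x (u - ∑ j, η j x u • ξ j x) (fun i ↦ by simp [h.η_ξ]) i
  simpa [h.f_ξ] using h1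

/-- If `f u = 0`, both sides have the same image under the injective map `Q`. -/
theorem IsFramedWeakF.eq_sum_of_f_eq_zero (h : IsFramedWeakF n s f Q ξ η) {x : M}
    {u : TangentSpace I x} (hu : f x u = 0) : u = ∑ i, η i x u • ξ i x := by
  have h1 := h.sq x u
  rw [hu, map_zero, eq_comm, neg_add_eq_zero] at h1
  refine (h.nonsingular_Q x).injective ?_
  rw [h1]
  simp [h.Q_ξ]

/-- Compatibility with second argument `ξ_i`, where `f ξ_i = 0` and `Q ξ_i = ξ_i`. -/
theorem IsWeakMetricF.η_eq [IsContMDiffRiemannianBundle I ∞ E (fun x : M ↦ TangentSpace I x)]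
    (h : IsWeakMetricF n s f Q ξ η) (x : M) (i : Fin s) (u : TangentSpace I x) :
    η i x u = inner ℝ (ξ i x) u := by
  have h1 := h.compatible x u (ξ i x)
  rw [h.f_ξ, h.Q_ξ, inner_zero_right] at h1
  simp only [h.η_ξ, mul_ite, mul_one, mul_zero, Finset.sum_ite_eq', Finset.mem_univ, if_true] at h1
  rw [real_inner_comm]
  linarith

variable [IsContMDiffRiemannianBundle I ∞ E (fun x : M ↦ TangentSpace I x)] [T2Space M]

/-- The characteristic fields as smooth fields. -/
def IsFramedWeakF.field (h : IsFramedWeakF n s f Q ξ η) (i : Fin s) : SmoothField I M :=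
  ⟨ξ i, h.smooth_ξ i⟩

theorem proj_apply (Ξ : Fin s → SmoothField I M) (X : SmoothField I M) (x : M) :
    (lcAlg I M).proj Ξ X x = X x - ∑ i, (inner ℝ (Ξ i x) (X x) : ℝ) • Ξ i x := by
  rw [MetricLieRinehart.proj, ContMDiffSection.coe_sub, Pi.sub_apply, smoothField_sum_apply]
  rfl

theorem etaSum_apply (Ξ : Fin s → SmoothField I M) (X : SmoothField I M) (x : M) :
    (lcAlg I M).etaSum Ξ X x = ∑ i, (inner ℝ (Ξ i x) (X x) : ℝ) := by
  rw [MetricLieRinehart.etaSum, smoothFun_sum_apply]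
  rfl

theorem IsWeakMetricF.g_field (h : IsWeakMetricF n s f Q ξ η) (i j : Fin s) :
    (lcAlg I M).g (h.field i) (h.field j) = if i = j then 1 else 0 := by
  ext x
  refine (h.η_eq x i (ξ j x)).symm.trans ((h.η_ξ x i j).trans ?_)
  split_ifs <;> rfl

variable {β : ℝ}

/-- In the Kenmotsu equation with `Y = ξ_i` the `ξ̄` term drops out, as `g(f X, ξ_i) = η^i(f X) =
0`. -/
theorem IsWeakKenmotsuF.f_leviCivita_ξ (h : IsWeakKenmotsuF n s f Q ξ η (fun _ ↦ β))
    (X : SmoothField I M) (x : M) (i : Fin s) :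
    f x (leviCivita (ξ i) x (X x)) = β • f x (X x) := by
  have h1 := h.kenmotsu X (ξ i) X.contMDiff (h.smooth_ξ i) x
  have h0 : (fun y ↦ f y (ξ i y)) = 0 := funext fun y ↦ h.f_ξ y i
  have h2 : etaBar η x (ξ i x) = 1 := by simp [etaBar, h.η_ξ]
  rw [nablaEndo, h0, CovariantDerivative.zero, h2, real_inner_comm, ← h.η_eq, h.η_f] at h1
  simpa using h1

/-- `∇_X ξ_i - β X` lies in `ker f`, hence is a combination of the `ξ_j`. -/
theorem IsWeakKenmotsuF.cov_field_apply (h : IsWeakKenmotsuF n s f Q ξ η (fun _ ↦ β))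
    (X : SmoothField I M) (x : M) (i : Fin s) :
    (lcAlg I M).cov X (h.field i) x = β • (lcAlg I M).proj h.field X x
      + ∑ j, (lcAlg I M).g ((lcAlg I M).cov X (h.field i)) (h.field j) x • ξ j x := by
  have h1 : f x ((lcAlg I M).cov X (h.field i) x - β • X x) = 0 := by
    rw [map_sub, map_smul, sub_eq_zero]
    exact h.f_leviCivita_ξ X x i
  have h2 := h.eq_sum_of_f_eq_zero h1
  have h3 (j) : η j x ((lcAlg I M).cov X (h.field i) x - β • X x)
      = (lcAlg I M).g ((lcAlg I M).cov X (h.field i)) (h.field j) x - β * inner ℝ (ξ j x) (X x) :=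
          by
    rw [map_sub, map_smul, h.η_eq, h.η_eq, real_inner_comm]
    rfl
  simp only [h3, sub_smul, Finset.sum_sub_distrib] at h2
  rw [sub_eq_iff_eq_add] at h2
  rw [h2, proj_apply, smul_sub, Finset.smul_sum]
  simp only [smul_smul]
  change _ = _ - ∑ j, (β * inner ℝ (ξ j x) (X x)) • ξ j x + _
  abel

/-- This is the vanishing of the Lie derivative of `η^m` along `ξ_i`, written with the connection.
Applied to normality for `(X, ξ_i)`, `η^m` kills the Nijenhuis terms, which are images of `f` or
contain `f ξ_i = 0`; what remains is `dη^m(X, ξ_i) = 0`. -/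
theorem IsWeakKenmotsuF.lie_η (h : IsWeakKenmotsuF n s f Q ξ η (fun _ ↦ β))
    (X : SmoothField I M) (i m : Fin s) :
    (lcAlg I M).g ((lcAlg I M).cov X (h.field i)) (h.field m) + (lcAlg I M).g ((lcAlg I M).cov
        (h.field i) (h.field m)) X = 0 := by
  have h0 : (fun y ↦ f y (ξ i y)) = 0 := funext fun y ↦ h.f_ξ y i
  have key (x) : extDeriv (η m) X (ξ i) x = 0 := by
    have h1 := congrArg (η m x) (h.normal X (ξ i) X.contMDiff (h.smooth_ξ i) x)
    simp only [nijenhuis, h0, mlieBracket_zero_right, map_add, map_sub, h.η_f, map_sum, map_smul,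
      h.η_ξ] at h1
    simpa using h1
  have h2 : (lcAlg I M).D (h.field i) ((lcAlg I M).g (h.field m) X)
      + (lcAlg I M).g (h.field m) ((lcAlg I M).bracket X (h.field i)) = 0 := by
    ext x
    have h3 := key x
    have h4 : (fun y ↦ η m y (ξ i y)) = fun _ ↦ if m = i then 1 else 0 :=
      funext fun y ↦ h.η_ξ y m i
    have h5 : (fun y ↦ η m y (X y)) = (lcAlg I M).g (h.field m) X := funext fun y ↦ h.η_eq y m (X y)
    rw [extDeriv, h4, h5, mvfderiv_const, h.η_eq] at h3
    rw [lcAlg_bracket]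
    change d% ((lcAlg I M).g (h.field m) X) x (ξ i x) + inner ℝ (ξ m x) (mlieBracket I X
        (ξ i) x) = 0
    simp at h3
    linarith
  rw [MetricLieRinehart.metric, MetricLieRinehart.bracket_def, map_sub] at h2
  rw [(lcAlg I M).g_comm _ (h.field m)]
  linear_combination h2

/-- The covariant derivatives of the characteristic fields. -/
theorem IsWeakKenmotsuF.cov_field (h : IsWeakKenmotsuF n s f Q ξ η (fun _ ↦ β))
    (X : SmoothField I M) (i : Fin s) :
    (lcAlg I M).cov X (h.field i) = (ContMDiffMap.const β : SmoothFun I M)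
        • (lcAlg I M).proj h.field X := by
  have anti (X i j) : (lcAlg I M).g ((lcAlg I M).cov X (h.field i)) (h.field j) +
      (lcAlg I M).g ((lcAlg I M).cov X (h.field j)) (h.field i) = 0 := by
    have h1 := (lcAlg I M).metric X (h.field i) (h.field j)
    rw [h.g_field, (lcAlg I M).g_comm (h.field i)] at h1
    rw [← h1]
    split_ifs <;> simp
  let c (i j k) := (lcAlg I M).g ((lcAlg I M).cov (h.field i) (h.field j)) (h.field k)
  have hc (i j k) : c i j k = 0 := by
    have a (i j k) : c i j k + c i k j = 0 := anti _ _ _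
    have b (i j k) : c i j k + c j k i = 0 := h.lie_η _ _ _
    refine (lcAlg I M).add_self_cancel _ ?_
    -- A cyclic shift of the indices changes the sign of `c`; three shifts give `c = -c`.
    linear_combination b i j k - b j k i + b k i j
  have h0 (i j) : (lcAlg I M).cov (h.field i) (h.field j) = 0 := by
    ext x
    rw [h.cov_field_apply]
    have h1 (k) : (lcAlg I M).g ((lcAlg I M).cov (h.field i) (h.field j)) (h.field k) = 0 :=
        hc i j k
    have h2 : (lcAlg I M).proj h.field (h.field i) = 0 := by
      simp [MetricLieRinehart.proj, h.g_field]
    simp [h1, h2]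
  -- As `∇_{ξ_i} ξ_j = 0`, the second term of `lie_η` disappears for arbitrary `X`.
  have h1 (j) : (lcAlg I M).g ((lcAlg I M).cov X (h.field i)) (h.field j) = 0 := by
    simpa [h0] using h.lie_η X i j
  ext x
  rw [h.cov_field_apply]
  simp only [h1]
  simp only [smoothFun_smul_apply, ContMDiffMap.coe_zero, Pi.zero_apply, zero_smul,
    Finset.sum_const_zero, add_zero]
  rfl

end Structure

/-! ### Ricci curvature in the characteristic directions and its Lie derivative. -/

section RicciCurvature

open scoped Topology
open Filter

variable {E : Type*} [NormedAddCommGroup E] [NormedSpace ℝ E] [FiniteDimensional ℝ E]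
  {H : Type*} [TopologicalSpace H] {I : ModelWithCorners ℝ E H}
  {M : Type*} [TopologicalSpace M] [ChartedSpace H M] [IsManifold I ∞ M]
  [RiemannianBundle (fun x : M ↦ TangentSpace I x)]
  {n s : ℕ} {f Q : Π x : M, TangentSpace I x →L[ℝ] TangentSpace I x}
  {ξ : Fin s → Π x : M, TangentSpace I x} {η : Fin s → Π x : M, TangentSpace I x →L[ℝ] ℝ}

/-- The projection `u - ∑ η^i(u) ξ_i` of a tangent space to the contact distribution. -/
noncomputable def contactProj (ξ : Fin s → Π x : M, TangentSpace I x)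
    (η : Fin s → Π x : M, TangentSpace I x →L[ℝ] ℝ) (x : M) :
    TangentSpace I x →ₗ[ℝ] TangentSpace I x :=
  LinearMap.id - ∑ i, (η i x : TangentSpace I x →ₗ[ℝ] ℝ).smulRight (ξ i x)

theorem contactProj_apply (x : M) (u : TangentSpace I x) :
    contactProj ξ η x u = u - ∑ i, η i x u • ξ i x := by
  simp [contactProj]

theorem IsFramedWeakF.trace_contactProj (h : IsFramedWeakF n s f Q ξ η) (x : M) :
    LinearMap.trace ℝ (TangentSpace I x) (contactProj ξ η x) = 2 * n := by
  have hd : finrank ℝ (TangentSpace I x) = 2 * n + s := h.dim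
  have h1 := LinearMap.trace_id ℝ (TangentSpace I x)
  rw [contactProj, map_sub, map_sum, h1, hd]
  simp only [LinearMap.trace_smulRight]
  simp [h.η_ξ]

theorem IsFramedWeakF.η_contactProj (h : IsFramedWeakF n s f Q ξ η) (x : M) (i : Fin s)
    (u : TangentSpace I x) : η i x (contactProj ξ η x u) = 0 := by
  simp [contactProj_apply, h.η_ξ]

theorem IsFramedWeakF.etaBar_contactProj (h : IsFramedWeakF n s f Q ξ η) (x : M)
    (u : TangentSpace I x) : etaBar η x (contactProj ξ η x u) = 0 := by
  simp [etaBar, h.η_contactProj]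

theorem IsFramedWeakF.contactProj_ξ (h : IsFramedWeakF n s f Q ξ η) (x : M) (i : Fin s) :
    contactProj ξ η x (ξ i x) = 0 := by
  simp [contactProj_apply, h.η_ξ]

theorem IsFramedWeakF.contactProj_xiBar (h : IsFramedWeakF n s f Q ξ η) (x : M) :
    contactProj ξ η x (xiBar ξ x) = 0 := by
  simp [xiBar, h.contactProj_ξ]

theorem IsFramedWeakF.etaBar_ξ (h : IsFramedWeakF n s f Q ξ η) (x : M) (i : Fin s) :
    etaBar η x (ξ i x) = 1 := by
  simp [etaBar, h.η_ξ]

theorem IsFramedWeakF.etaBar_xiBar (h : IsFramedWeakF n s f Q ξ η) (x : M) :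
    etaBar η x (xiBar ξ x) = s := by
  simp [xiBar, h.etaBar_ξ]

theorem IsFramedWeakF.contactProj_contactProj (h : IsFramedWeakF n s f Q ξ η) (x : M)
    (u : TangentSpace I x) :
    contactProj ξ η x (contactProj ξ η x u) = contactProj ξ η x u := by
  rw [contactProj_apply]
  simp [h.η_contactProj]

variable [IsContMDiffRiemannianBundle I ∞ E (fun x : M ↦ TangentSpace I x)]

theorem IsWeakMetricF.etaBar_eq (h : IsWeakMetricF n s f Q ξ η) (x : M) (u : TangentSpace I x) :
    etaBar η x u = inner ℝ (xiBar ξ x) u := by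
  simp [etaBar, xiBar, sum_inner, h.η_eq]

theorem IsWeakMetricF.inner_contactProj (h : IsWeakMetricF n s f Q ξ η) (x : M)
    (u v : TangentSpace I x) :
    (inner ℝ (contactProj ξ η x u) v : ℝ) = inner ℝ u v - ∑ i, η i x u * η i x v := by
  simp [contactProj_apply, inner_sub_left, sum_inner, real_inner_smul_left, h.η_eq]

theorem IsWeakMetricF.inner_contactProj_comm (h : IsWeakMetricF n s f Q ξ η) (x : M)
    (u v : TangentSpace I x) :
    (inner ℝ (contactProj ξ η x u) v : ℝ) = inner ℝ u (contactProj ξ η x v) := by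
  rw [← real_inner_comm u, h.inner_contactProj, h.inner_contactProj, real_inner_comm]
  simp only [mul_comm]

variable [T2Space M]

theorem IsWeakMetricF.proj_field_apply (h : IsWeakMetricF n s f Q ξ η)
    (X : SmoothField I M) (x : M) : (lcAlg I M).proj h.field X x = contactProj ξ η x (X x) := by
  rw [proj_apply, contactProj_apply]
  simp only [h.η_eq]
  rfl

theorem IsWeakMetricF.etaSum_field_apply (h : IsWeakMetricF n s f Q ξ η)
    (X : SmoothField I M) (x : M) : (lcAlg I M).etaSum h.field X x = etaBar η x (X x) := by
  rw [etaSum_apply, etaBar]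
  simp only [FunLike.coe_sum, Finset.sum_apply, h.η_eq]
  rfl

variable (I M) in
theorem D_const (X : SmoothField I M) (c : ℝ) :
    (lcAlg I M).D X (ContMDiffMap.const c) = 0 := by
  ext x
  exact congr($(mvfderiv_const (I := I) (M := M) c) (X x))

theorem exists_orthonormal_smoothField (x : M) :
    ∃ e : Fin (finrank ℝ E) → SmoothField I M, ∀ᶠ y in 𝓝 x, Orthonormal ℝ (fun a ↦ e a y) :=
  let ⟨e, he, h⟩ := exists_orthonormal_frame (I := I) x
  ⟨fun a ↦ ⟨e a, he a⟩, h⟩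

theorem ricci_eq_sum_curv {x : M} {e : Fin (finrank ℝ E) → SmoothField I M}
    (he : Orthonormal ℝ (fun a ↦ e a x)) (Y Z : SmoothField I M) :
    ricci x (Y x) (Z x) = (∑ a, (lcAlg I M).g ((lcAlg I M).curv (e a) Y Z) (e a) :
        SmoothFun I M) x := by
  obtain ⟨b, hb⟩ := exists_orthonormalBasis_eq he
  rw [ricci_eq_sum b, smoothFun_sum_apply, hb]
  exact Finset.sum_congr rfl fun a _ ↦
    congr(inner ℝ $(curvatureAt_apply (e a) Y Z x) (e a x))

theorem lcAlg_D_congr {x : M} {V : SmoothField I M} {φ ψ : SmoothFun I M}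
    (h : ⇑φ =ᶠ[𝓝 x] ⇑ψ) : (lcAlg I M).D V φ x = (lcAlg I M).D V ψ x := by
  rw [lcAlg_D_apply, lcAlg_D_apply, mvfderiv, mvfderiv]
  rw [h.mfderiv_eq]
  rfl

/-- The covariant derivatives of an orthonormal frame are skew symmetric in the frame. -/
theorem inner_cov_add_inner_cov {x : M} {ι : Type*} {e : ι → SmoothField I M}
    (he : ∀ᶠ y in 𝓝 x, Orthonormal ℝ (fun a ↦ e a y)) (V : SmoothField I M) (a c : ι) :
    (inner ℝ ((lcAlg I M).cov V (e a) x) (e c x) : ℝ) + inner ℝ (e a x) ((lcAlg I M).cov V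
        (e c) x) = 0 := by
  classical
  have h1 : (lcAlg I M).D V ((lcAlg I M).g (e a) (e c)) x = 0 := by
    refine (lcAlg_D_congr (ψ := ContMDiffMap.const (if a = c then 1 else 0)) ?_).trans
      congr($(D_const I M V _) x)
    filter_upwards [he] with y hy
    exact orthonormal_iff_ite.1 hy a c
  rw [MetricLieRinehart.metric] at h1
  exact h1

variable {β : ℝ}

theorem IsWeakKenmotsuF.curv_field_apply (h : IsWeakKenmotsuF n s f Q ξ η (fun _ ↦ β))
    (X Y : SmoothField I M) (i : Fin s) (x : M) :
    (lcAlg I M).curv X Y (h.field i) x = β ^ 2 • (etaBar η x (X x) • contactProj ξ η x (Y x)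
      - etaBar η x (Y x) • contactProj ξ η x (X x)) := by
  rw [MetricLieRinehart.curv_xi (fun X ↦ D_const I M X β) h.cov_field]
  simp only [← h.proj_field_apply, ← h.etaSum_field_apply]
  rfl

theorem IsWeakKenmotsuF.curvatureAt_ξ (h : IsWeakKenmotsuF n s f Q ξ η (fun _ ↦ β))
    {x : M} (u v : TangentSpace I x) (i : Fin s) :
    curvatureAt x u v (ξ i x) = β ^ 2 • (etaBar η x u • contactProj ξ η x v
      - etaBar η x v • contactProj ξ η x u) := by
  obtain ⟨X, rfl⟩ := exists_smoothField u
  obtain ⟨Y, rfl⟩ := exists_smoothField v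
  rw [← h.curv_field_apply X Y i x, ← curvatureAt_apply]
  rfl

/-- The trace of `z ↦ β² (η̄(z) P u - η̄(u) P z)`: the first part contributes `η̄(P u) = 0`, the
second `tr P = 2n`. -/
theorem IsWeakKenmotsuF.ricci_ξ (h : IsWeakKenmotsuF n s f Q ξ η (fun _ ↦ β))
    {x : M} (u : TangentSpace I x) (i : Fin s) :
    ricci x u (ξ i x) = -2 * n * β ^ 2 * etaBar η x u := by
  have h1 : jacobiOp x u (ξ i x) = β ^ 2 • ((etaBar η x : TangentSpace I x →ₗ[ℝ] ℝ).smulRight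
      (contactProj ξ η x u) - etaBar η x u • contactProj ξ η x) :=
    LinearMap.ext fun z ↦ h.curvatureAt_ξ z u i
  rw [ricci_eq_trace, h1, map_smul, map_sub, map_smul, LinearMap.trace_smulRight,
    h.trace_contactProj]
  simp [h.etaBar_contactProj]
  ring

theorem IsWeakKenmotsuF.ricciOp_ξ (h : IsWeakKenmotsuF n s f Q ξ η (fun _ ↦ β))
    (x : M) (i : Fin s) : ricciOp x (ξ i x) = (-2 * n * β ^ 2) • xiBar ξ x := by
  refine ext_inner_right ℝ fun w ↦ ?_
  change inner ℝ (ricciLin x (ξ i x)) w = _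
  rw [inner_ricciLin, ricci_comm, h.ricci_ξ, real_inner_smul_left, h.etaBar_eq]

theorem IsWeakKenmotsuF.ricci_contactProj (h : IsWeakKenmotsuF n s f Q ξ η (fun _ ↦ β))
    {x : M} (u v : TangentSpace I x) :
    ricci x u (contactProj ξ η x v) =
      ricci x u v + 2 * n * β ^ 2 * etaBar η x u * etaBar η x v := by
  rw [← inner_ricciLin, contactProj_apply, inner_sub_right, inner_sum]
  simp only [real_inner_smul_right, inner_ricciLin, h.ricci_ξ, ← Finset.sum_mul]
  simp [etaBar]
  ring

/-- With `K` the skew endomorphism `b a ↦ k a`, the sum is `tr(T K) + tr(Kᵀ T) = 0`. It removes the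
derivatives of an orthonormal frame from a contraction. -/
theorem sum_inner_add_inner_eq_zero {V ι : Type*} [NormedAddCommGroup V] [InnerProductSpace ℝ V]
    [Fintype ι] (b : OrthonormalBasis ι ℝ V) (T : V →ₗ[ℝ] V) (k : ι → V)
    (hk : ∀ a c, (inner ℝ (k a) (b c) : ℝ) + inner ℝ (b a) (k c) = 0) :
    ∑ a, ((inner ℝ (T (k a)) (b a) : ℝ) + inner ℝ (T (b a)) (k a)) = 0 := by
  have h1 (a) : (inner ℝ (T (k a)) (b a) : ℝ) = ∑ c, inner ℝ (b c) (k a) * inner ℝ (T (b c))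
      (b a) := by
    conv_lhs => rw [← b.sum_repr' (k a)]
    simp [sum_inner, real_inner_smul_left]
  have h2 (a) : (inner ℝ (T (b a)) (k a) : ℝ) = ∑ c, inner ℝ (b c) (k a) * inner ℝ (T (b a))
      (b c) := by
    conv_lhs => rw [← b.sum_repr' (k a)]
    simp [inner_sum, real_inner_smul_right]
  simp only [h1, h2, Finset.sum_add_distrib]
  rw [Finset.sum_comm, ← Finset.sum_add_distrib]
  refine Finset.sum_eq_zero fun a _ ↦ ?_
  rw [← Finset.sum_add_distrib]
  refine Finset.sum_eq_zero fun c _ ↦ ?_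
  rw [← add_mul, real_inner_comm (k a), add_comm, hk, zero_mul]

/-- The trace of the Lie derivative of the curvature along a characteristic field. -/
theorem IsWeakKenmotsuF.sum_inner_lieCurv (h : IsWeakKenmotsuF n s f Q ξ η (fun _ ↦ β))
    {ι : Type*} [Fintype ι] {x : M} (b : OrthonormalBasis ι ℝ (TangentSpace I x))
    {e : ι → SmoothField I M} (he : ∀ a, e a x = b a) (Y Z : SmoothField I M) :
    ∑ a, (inner ℝ ((lcAlg I M).lieCurv h.field (ContMDiffMap.const β) (e a) Y Z x) (b a) : ℝ) =
      -(4 * n * s * β ^ 3) * inner ℝ (contactProj ξ η x (Y x)) (Z x) := by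
  let hZ : TangentSpace I x →ₗ[ℝ] ℝ :=
    (innerSL ℝ (contactProj ξ η x (Z x)) : TangentSpace I x →ₗ[ℝ] ℝ)
  -- `lieCurv` as an endomorphism in its first argument, so that the sum is a trace.
  let T : TangentSpace I x →ₗ[ℝ] TangentSpace I x := -(2 * β ^ 3) •
    ((s : ℝ) • (hZ (Y x) • contactProj ξ η x - hZ.smulRight (contactProj ξ η x (Y x)))
      - (etaBar η x (Y x) • hZ - hZ (Y x) • (etaBar η x : TangentSpace I x →ₗ[ℝ] ℝ)).smulRight
        (xiBar ξ x))
  have hT (a) : (lcAlg I M).lieCurv h.field (ContMDiffMap.const β) (e a) Y Z x = T (b a) := by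
    have hs : ((s : SmoothFun I M) : M → ℝ) x = s := by
      rw [← ContMDiffMap.coeFnRingHom_apply, map_natCast, Pi.natCast_apply]
    have hβ : (-(2 * ContMDiffMap.const β ^ 3) : SmoothFun I M) x = -(2 * β ^ 3) := by
      rw [← ContMDiffMap.coeFnRingHom_apply]
      simp only [map_neg, map_mul, map_pow, map_ofNat]
      rfl
    have hg (X : SmoothField I M) : (lcAlg I M).g ((lcAlg I M).proj h.field X) Z x = hZ (X x) := by
      change (inner ℝ ((lcAlg I M).proj h.field X x) (Z x) : ℝ) = inner ℝ (contactProj ξ η x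
          (Z x)) (X x)
      rw [h.proj_field_apply, h.inner_contactProj_comm, real_inner_comm]
    have hη (c : SmoothFun I M) : (c - (lcAlg I M).etaSum h.field (e a) * (lcAlg I M).g
        ((lcAlg I M).proj h.field Y) Z) x
        = c x - (lcAlg I M).etaSum h.field (e a) x * (lcAlg I M).g
            ((lcAlg I M).proj h.field Y) Z x := rfl
    have hη' (X : SmoothField I M) : ((lcAlg I M).etaSum h.field Y * (lcAlg I M).g
        ((lcAlg I M).proj h.field X) Z) x
        = (lcAlg I M).etaSum h.field Y x * (lcAlg I M).g ((lcAlg I M).proj h.field X) Z x := rfl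
    have hf (i) : h.field i x = ξ i x := rfl
    simp only [MetricLieRinehart.lieCurv, smoothFun_smul_apply, ContMDiffSection.coe_sub,
      Pi.sub_apply, smoothField_sum_apply, hs, hβ, hg, hη, hη', h.proj_field_apply,
      h.etaSum_field_apply, he, hf]
    simp only [T, LinearMap.smul_apply, LinearMap.sub_apply, LinearMap.smulRight_apply,
      ContinuousLinearMap.coe_coe, xiBar, smul_eq_mul]
    rw [mul_comm (hZ (Y x))]
  simp only [hT]
  rw [sum_inner_eq_trace b]
  have h1 : hZ (xiBar ξ x) = 0 := by
    change inner ℝ (contactProj ξ η x (Z x)) (xiBar ξ x) = (0 : ℝ)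
    rw [h.inner_contactProj_comm, h.contactProj_xiBar, inner_zero_right]
  have h2 : hZ (Y x) = inner ℝ (contactProj ξ η x (Y x)) (Z x) := by
    change inner ℝ (contactProj ξ η x (Z x)) (Y x) = (_ : ℝ)
    rw [h.inner_contactProj_comm, real_inner_comm]
  have h3 : hZ (contactProj ξ η x (Y x)) = hZ (Y x) := by
    change inner ℝ (contactProj ξ η x (Z x)) _ = (inner ℝ (contactProj ξ η x (Z x)) (Y x) : ℝ)
    rw [← h.inner_contactProj_comm, h.contactProj_contactProj]
  -- The first group contributes `s (2n - 1)` and the `ξ̄` term `η̄(ξ̄) = s`: together `2ns`, times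
  -- `-2β³`.
  simp only [T, map_smul, map_sub, LinearMap.trace_smulRight, h.trace_contactProj, h3,
    LinearMap.sub_apply, LinearMap.smul_apply, h1, ← h2, ContinuousLinearMap.coe_coe,
    h.etaBar_xiBar, smul_eq_mul]
  ring

/-- The Lie derivative of the Ricci tensor along a characteristic field. -/
theorem IsWeakKenmotsuF.mvfderiv_ricci (h : IsWeakKenmotsuF n s f Q ξ η (fun _ ↦ β))
    (Y Z : SmoothField I M) (i : Fin s) (x : M) :
    (lcAlg I M).D (h.field i) (ricciFun Y Z) x =
      ricci x ((lcAlg I M).bracket (h.field i) Y x) (Z x) + ricci x (Y x) ((lcAlg I M).bracket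
          (h.field i) Z x)
        - 4 * n * s * β ^ 3 * inner ℝ (contactProj ξ η x (Y x)) (Z x) := by
  obtain ⟨e, hon⟩ := exists_orthonormal_smoothField (I := I) x
  obtain ⟨b, hb⟩ := exists_orthonormalBasis_eq hon.self_of_nhds
  have hb (a) : e a x = b a := by rw [hb]
  have hev : ⇑(ricciFun Y Z) =ᶠ[𝓝 x] ⇑(∑ a, (lcAlg I M).g ((lcAlg I M).curv (e a) Y Z) (e a)) := by
    filter_upwards [hon] with y hy
    exact ricci_eq_sum_curv hy Y Z
  -- Here `∇_{ξ_i}` acts on `R(e_a, Y) Z` as Lie derivative plus `β P`, and `[ξ_i, e_a] = ∇_{ξ_i}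
  -- e_a - β P e_a`. The frame terms thus split into a skew part and a commutator with `P`.
  have hterm (a) : (lcAlg I M).D (h.field i) ((lcAlg I M).g ((lcAlg I M).curv (e a) Y Z) (e a)) =
      ((lcAlg I M).g ((lcAlg I M).curv ((lcAlg I M).cov (h.field i) (e a)) Y Z) (e a)
        + (lcAlg I M).g ((lcAlg I M).curv (e a) Y Z) ((lcAlg I M).cov (h.field i) (e a)))
      + ContMDiffMap.const β * ((lcAlg I M).g ((lcAlg I M).proj h.field ((lcAlg I M).curv
          (e a) Y Z)) (e a)
        - (lcAlg I M).g ((lcAlg I M).curv ((lcAlg I M).proj h.field (e a)) Y Z) (e a))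
      + (lcAlg I M).g ((lcAlg I M).curv (e a) ((lcAlg I M).bracket (h.field i) Y) Z) (e a)
      + (lcAlg I M).g ((lcAlg I M).curv (e a) Y ((lcAlg I M).bracket (h.field i) Z)) (e a)
      + (lcAlg I M).g ((lcAlg I M).lieCurv h.field (ContMDiffMap.const β) (e a) Y Z) (e a) := by
    have h1 := (lcAlg I M).bracket_def (h.field i) ((lcAlg I M).curv (e a) Y Z)
    rw [MetricLieRinehart.lie_curv (fun X ↦ D_const I M X β) h.cov_field, h.cov_field,
      eq_sub_iff_add_eq, (lcAlg I M).bracket_def (h.field i) (e a), h.cov_field] at h1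
    have h2 : (lcAlg I M).curv ((lcAlg I M).cov (h.field i) (e a)) Y Z =
        (lcAlg I M).curv ((lcAlg I M).cov (h.field i) (e a)
          - (ContMDiffMap.const β : SmoothFun I M) • (lcAlg I M).proj h.field (e a)) Y Z
        + (ContMDiffMap.const β : SmoothFun I M) • (lcAlg I M).curv ((lcAlg I M).proj h.field
            (e a)) Y Z := by
      rw [← MetricLieRinehart.curv_smul_left, ← MetricLieRinehart.curv_add_left, sub_add_cancel]
    rw [MetricLieRinehart.metric, ← h1, h2]
    simp only [map_add, LinearMap.add_apply, map_smul, LinearMap.smul_apply, smul_eq_mul]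
    ring
  rw [lcAlg_D_congr hev, map_sum, smoothFun_sum_apply]
  simp only [hterm]
  let T := jacobiOp x (Y x) (Z x)
  have hT (X : SmoothField I M) : (lcAlg I M).curv X Y Z x = T (X x) :=
      (curvatureAt_apply X Y Z x).symm
  -- `tr(P T) = tr(T P)` cancels the two terms with factor `β`.
  have hP : LinearMap.trace ℝ (TangentSpace I x) (contactProj ξ η x * T) =
      LinearMap.trace ℝ _ (T * contactProj ξ η x) := LinearMap.trace_mul_comm ..
  have hR (Y Z : SmoothField I M) : ∑ a, (lcAlg I M).g ((lcAlg I M).curv (e a) Y Z) (e a) x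
      = ricci x (Y x) (Z x) := by
    rw [← smoothFun_sum_apply, ← ricci_eq_sum_curv hon.self_of_nhds]
  have hsum := sum_inner_add_inner_eq_zero b T (fun a ↦ (lcAlg I M).cov (h.field i) (e a) x) (by
    intro a c
    rw [← hb, ← hb]
    exact inner_cov_add_inner_cov hon (h.field i) a c)
  have hlie := h.sum_inner_lieCurv b hb Y Z
  rw [← sum_inner_eq_trace b, ← sum_inner_eq_trace b] at hP
  have hstep (a) : (((lcAlg I M).g ((lcAlg I M).curv ((lcAlg I M).cov (h.field i) (e a)) Y Z) (e a)
        + (lcAlg I M).g ((lcAlg I M).curv (e a) Y Z) ((lcAlg I M).cov (h.field i) (e a)))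
      + ContMDiffMap.const β * ((lcAlg I M).g ((lcAlg I M).proj h.field ((lcAlg I M).curv
          (e a) Y Z)) (e a)
        - (lcAlg I M).g ((lcAlg I M).curv ((lcAlg I M).proj h.field (e a)) Y Z) (e a))
      + (lcAlg I M).g ((lcAlg I M).curv (e a) ((lcAlg I M).bracket (h.field i) Y) Z) (e a)
      + (lcAlg I M).g ((lcAlg I M).curv (e a) Y ((lcAlg I M).bracket (h.field i) Z)) (e a)
      + (lcAlg I M).g ((lcAlg I M).lieCurv h.field (ContMDiffMap.const β) (e a) Y Z) (e a) :
          SmoothFun I M) x =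
      ((inner ℝ (T ((lcAlg I M).cov (h.field i) (e a) x)) (b a) : ℝ)
        + inner ℝ (T (b a)) ((lcAlg I M).cov (h.field i) (e a) x))
      + β * (inner ℝ ((contactProj ξ η x * T) (b a)) (b a)
        - inner ℝ ((T * contactProj ξ η x) (b a)) (b a))
      + (lcAlg I M).g ((lcAlg I M).curv (e a) ((lcAlg I M).bracket (h.field i) Y) Z) (e a) x
      + (lcAlg I M).g ((lcAlg I M).curv (e a) Y ((lcAlg I M).bracket (h.field i) Z)) (e a) x
      + inner ℝ ((lcAlg I M).lieCurv h.field (ContMDiffMap.const β) (e a) Y Z x) (b a) := by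
    simp only [Module.End.mul_apply, ← hb, ← h.proj_field_apply, ← hT]
    rfl
  simp only [hstep, Finset.sum_add_distrib, ← Finset.mul_sum, Finset.sum_sub_distrib, hP, hR, hlie]
  rw [← Finset.sum_add_distrib, hsum]
  ring

end RicciCurvature

/-! ### Covariant derivative of the Ricci operator and derivative of `r`. -/

section Main

open scoped Topology
open Filter

variable {E : Type*} [NormedAddCommGroup E] [NormedSpace ℝ E] [FiniteDimensional ℝ E]
  {H : Type*} [TopologicalSpace H] {I : ModelWithCorners ℝ E H}
  {M : Type*} [TopologicalSpace M] [ChartedSpace H M] [IsManifold I ∞ M]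
  [RiemannianBundle (fun x : M ↦ TangentSpace I x)]
  {n s : ℕ} {f Q : Π x : M, TangentSpace I x →L[ℝ] TangentSpace I x}
  {ξ : Fin s → Π x : M, TangentSpace I x} {η : Fin s → Π x : M, TangentSpace I x →L[ℝ] ℝ}
  [IsContMDiffRiemannianBundle I ∞ E (fun x : M ↦ TangentSpace I x)] [T2Space M] {β : ℝ}

theorem IsWeakKenmotsuF.bracket_field_apply (h : IsWeakKenmotsuF n s f Q ξ η (fun _ ↦ β))
    (X : SmoothField I M) (i : Fin s) (x : M) :
    (lcAlg I M).bracket (h.field i) X x =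
      (lcAlg I M).cov (h.field i) X x - β • contactProj ξ η x (X x) := by
  rw [MetricLieRinehart.bracket_def, h.cov_field, ← h.proj_field_apply]
  rfl

theorem ricci_sub_left {x : M} (u u' v : TangentSpace I x) :
    ricci x (u - u') v = ricci x u v - ricci x u' v := by
  simp only [← inner_ricciLin, map_sub, inner_sub_left]

theorem ricci_sub_right {x : M} (u v v' : TangentSpace I x) :
    ricci x u (v - v') = ricci x u v - ricci x u v' := by
  simp only [← inner_ricciLin, inner_sub_right]

theorem ricci_smul_left {x : M} (c : ℝ) (u v : TangentSpace I x) :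
    ricci x (c • u) v = c * ricci x u v := by
  rw [ricci_comm, ricci_smul_right, ricci_comm]

/-- Substituting `[ξ_i, ·] = ∇_{ξ_i} - β P` in both slots contributes `-β (Ric + 2nβ² η̄ ⊗ η̄)`
twice. -/
theorem IsWeakKenmotsuF.D_ricciFun (h : IsWeakKenmotsuF n s f Q ξ η (fun _ ↦ β))
    (Y Z : SmoothField I M) (i : Fin s) (x : M) :
    (lcAlg I M).D (h.field i) (ricciFun Y Z) x =
      ricci x ((lcAlg I M).cov (h.field i) Y x) (Z x) + ricci x (Y x) ((lcAlg I M).cov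
          (h.field i) Z x)
        - 2 * β * ricci x (Y x) (Z x)
        - 4 * n * β ^ 3 * (s * inner ℝ (contactProj ξ η x (Y x)) (Z x)
          + etaBar η x (Y x) * etaBar η x (Z x)) := by
  rw [h.mvfderiv_ricci, h.bracket_field_apply, h.bracket_field_apply, ricci_sub_left,
    ricci_sub_right, ricci_smul_left, ricci_smul_right, ricci_comm (contactProj _ _ _ _),
    h.ricci_contactProj, h.ricci_contactProj, ricci_comm (Z x) (Y x)]
  ring

/-- Pairing with an arbitrary field `Z` and using metric compatibility reduces the claim to
`D_ricciFun`. -/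
theorem IsWeakKenmotsuF.nablaEndo_ricciOp (h : IsWeakKenmotsuF n s f Q ξ η (fun _ ↦ β))
    (X : SmoothField I M) (i : Fin s) (x : M) :
    nablaEndo ricciOp (ξ i) X x = (-2 * β) • ricciOp x (X x)
      - (4 * n * β ^ 3) • ((s : ℝ) • contactProj ξ η x (X x)
        + etaBar η x (X x) • xiBar ξ x) := by
  refine ext_inner_right ℝ fun w ↦ ?_
  obtain ⟨Z, rfl⟩ := exists_smoothField w
  let S : SmoothField I M := ⟨fun x ↦ ricciOp x (X x), contMDiff_ricciOp X⟩
  have hS (Z : SmoothField I M) : (lcAlg I M).g S Z = ricciFun X Z := by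
    ext y
    exact inner_ricciLin y (X y) (Z y)
  have h1 := (lcAlg I M).metric (h.field i) S Z
  rw [hS, hS] at h1
  have h2 := (h.D_ricciFun X Z i x).symm.trans congr($h1 x)
  have h3 : nablaEndo ricciOp (ξ i) X x =
      (lcAlg I M).cov (h.field i) S x - ricciLin x ((lcAlg I M).cov (h.field i) X x) := rfl
  have h4 : ((lcAlg I M).g ((lcAlg I M).cov (h.field i) S) Z + ricciFun X ((lcAlg I M).cov
      (h.field i) Z)) x =
    (inner ℝ ((lcAlg I M).cov (h.field i) S x) (Z x) : ℝ) + ricci x (X x) ((lcAlg I M).cov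
        (h.field i) Z x) := rfl
  rw [h4] at h2
  change _ = inner ℝ (_ • ricciLin x (X x) - _) _
  rw [h3, inner_sub_left, inner_sub_left, real_inner_smul_left, real_inner_smul_left,
    inner_add_left, real_inner_smul_left, real_inner_smul_left, ← h.etaBar_eq, inner_ricciLin,
    inner_ricciLin]
  linarith

/-- Contraction of `D_ricciFun` over an orthonormal frame, whose derivatives cancel by skewness. The
constant is `s tr P + |ξ̄|² = 2ns + s`. -/
theorem IsWeakKenmotsuF.mvfderiv_scalarCurvature (h : IsWeakKenmotsuF n s f Q ξ η (fun _ ↦ β))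
    (i : Fin s) (x : M) :
    d% (scalarCurvature I (M := M)) x (ξ i x) =
      -2 * β * (scalarCurvature I x + 2 * s * n * (2 * n + 1) * β ^ 2) := by
  let r : SmoothFun I M := ⟨scalarCurvature I, contMDiff_scalarCurvature⟩
  change (lcAlg I M).D (h.field i) r x = _
  obtain ⟨e, hon⟩ := exists_orthonormal_smoothField (I := I) x
  have hr {y : M} (b : OrthonormalBasis (Fin (finrank ℝ E)) ℝ (TangentSpace I y)) :
      scalarCurvature I y = ∑ a, ricci y (b a) (b a) := by
    rw [scalarCurvature_eq_trace, ← sum_inner_eq_trace b]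
    simp only [inner_ricciLin]
  have hev : ⇑r =ᶠ[𝓝 x] ⇑(∑ a, ricciFun (e a) (e a)) := by
    filter_upwards [hon] with y hy
    obtain ⟨b, hb⟩ := exists_orthonormalBasis_eq hy
    rw [smoothFun_sum_apply]
    refine (hr b).trans ?_
    rw [hb]
    rfl
  obtain ⟨b, hb⟩ := exists_orthonormalBasis_eq hon.self_of_nhds
  have hb (a) : e a x = b a := by rw [hb]
  rw [lcAlg_D_congr hev, map_sum, smoothFun_sum_apply]
  simp only [h.D_ricciFun, hb]
  have hsum := sum_inner_add_inner_eq_zero b (ricciLin x) (fun a ↦ (lcAlg I M).cov (h.field i)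
      (e a) x) (by
    intro a c
    rw [← hb, ← hb]
    exact inner_cov_add_inner_cov hon (h.field i) a c)
  simp only [inner_ricciLin] at hsum
  -- Parseval's identity for `|ξ̄|² = η̄(ξ̄) = s`.
  have hη : ∑ a, etaBar η x (b a) * etaBar η x (b a) = s := by
    have := b.sum_inner_mul_inner (xiBar ξ x) (xiBar ξ x)
    rw [← h.etaBar_eq, h.etaBar_xiBar] at this
    rw [← this]
    refine Finset.sum_congr rfl fun a _ ↦ ?_
    rw [h.etaBar_eq, real_inner_comm (xiBar ξ x) (b a)]
  rw [Finset.sum_sub_distrib, Finset.sum_sub_distrib, hsum, ← Finset.mul_sum, ← Finset.mul_sum,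
    Finset.sum_add_distrib, ← Finset.mul_sum, sum_inner_eq_trace b, h.trace_contactProj, hη, ← hr]
  ring

end Main

end WeakKenmotsu


theorem proposition2p3
    {E : Type*} [NormedAddCommGroup E] [NormedSpace ℝ E] [FiniteDimensional ℝ E]
    {H : Type*} [TopologicalSpace H] {I : ModelWithCorners ℝ E H}
    {M : Type*} [TopologicalSpace M] [ChartedSpace H M] [IsManifold I ∞ M]
    [BoundarylessManifold I M] [T2Space M] [SecondCountableTopology M]
    [RiemannianBundle (fun x : M ↦ TangentSpace I x)]
    [IsContMDiffRiemannianBundle I ∞ E (fun x : M ↦ TangentSpace I x)]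
    (n s : ℕ) (f Q : Π x : M, TangentSpace I x →L[ℝ] TangentSpace I x)
    (ξ : Fin s → Π x : M, TangentSpace I x)
    (η : Fin s → Π x : M, TangentSpace I x →L[ℝ] ℝ) (β : ℝ)
    (h : WeakKenmotsu.IsWeakKenmotsuF n s f Q ξ η (fun _ ↦ β)) :
    (∀ (i : Fin s) (X Y : Π x : M, TangentSpace I x), CMDiff ∞ (T% X) → CMDiff ∞ (T% Y) → ∀ x,
      WeakKenmotsu.curvature X Y (ξ i) x =
        β ^ 2 • (WeakKenmotsu.etaBar η x (X x) • Y x - WeakKenmotsu.etaBar η x (Y x) • X x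
          + ∑ p, (WeakKenmotsu.etaBar η x (Y x) * η p x (X x)
              - WeakKenmotsu.etaBar η x (X x) * η p x (Y x)) • ξ p x)) ∧
    (∀ (i : Fin s) (x : M),
      WeakKenmotsu.ricciOp x (ξ i x) = (-2 * n * β ^ 2) • WeakKenmotsu.xiBar ξ x) ∧
    (∀ (i : Fin s) (X : Π x : M, TangentSpace I x), CMDiff ∞ (T% X) →
      MDiff (T% (fun x ↦ WeakKenmotsu.ricciOp x (X x))) ∧
      ∀ x, WeakKenmotsu.nablaEndo WeakKenmotsu.ricciOp (ξ i) X x =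
        (-2 * β) • WeakKenmotsu.ricciOp x (X x)
          - (4 * n * β ^ 3) • ((s : ℝ) • (X x - ∑ j, η j x (X x) • ξ j x)
            + WeakKenmotsu.etaBar η x (X x) • WeakKenmotsu.xiBar ξ x)) ∧
    (∀ i : Fin s, MDiff (WeakKenmotsu.scalarCurvature I (M := M)) ∧
      ∀ x, d% (WeakKenmotsu.scalarCurvature I (M := M)) x (ξ i x) =
        -2 * β * (WeakKenmotsu.scalarCurvature I x + 2 * s * n * (2 * n + 1) * β ^ 2)) := by
  refine ⟨fun i X Y hX hY x ↦ ?_, fun i x ↦ h.ricciOp_ξ x i, fun i X hX ↦ ⟨?_, fun x ↦ ?_⟩,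
    fun i ↦ ⟨WeakKenmotsu.contMDiff_scalarCurvature.mdifferentiable (by simp),
      h.mvfderiv_scalarCurvature i⟩⟩
  · refine (WeakKenmotsu.lcAlg_curv_apply ⟨X, hX⟩ ⟨Y, hY⟩ (h.field i) x).symm.trans ?_
    rw [h.curv_field_apply, WeakKenmotsu.contactProj_apply, WeakKenmotsu.contactProj_apply]
    simp only [sub_smul, mul_smul, Finset.sum_sub_distrib, ← Finset.smul_sum,
      ContMDiffSection.coeFn_mk]
    module
  · exact (WeakKenmotsu.contMDiff_ricciOp ⟨X, hX⟩).mdifferentiable (by simp)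
  · rw [← WeakKenmotsu.contactProj_apply]
    exact h.nablaEndo_ricciOp ⟨X, hX⟩ i x
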